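/- **Setting.** Let $n\ge 1$, $L\ge 2n$ and $N$ be integers, and let $x_{k+1}=Ax_k+Bu_k$, $y_k=Cx_k+Du_k$ be a minimal (controllable and observable) linear system with $x_k\in\mathbb R^n$, $u_k\in\mathbb R^m$, $y_k\in\mathbb R^p$. Let $Q,R\succ0$, and let $\mathbb U\subseteq\mathbb R^m$ have $0$ in its interior. For a sequence $v_0,\dots,v_{N-1}$ let $H_d(v)$ be its block Hankel matrix with $d$ block rows and $N-d+1$ columns; $v$, with values in $\mathbb R^q$, is persistently exciting of order $d$ if $\operatorname{rank}H_d(v)=qd$. *Data.* $(u^d_k,x^d_k,y^d_k)_{k=0}^{N-1}$ is an input-state-output trajectory of the system with $u^d$ persistently exciting of order $L+2n$. What is known is $u^d$ and $\tilde y^d=y^d+\varepsilon^d$ with $\|\varepsilon^d_k\|_\infty\le\bar\varepsilon$. Put $H_{ux}=\begin{bmatrix}H_{L+n}(u^d)\\ x^d_0\ \cdots\ x^d_{N-L-n}\end{bmatrix}$, $H_{ux}^\dagger=H_{ux}^\top(H_{ux}H_{ux}^\top)^{-1}$ and $c_{pe}=\|H_{ux}^\dagger\|_2^2$. *Scheme.*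 Online outputs are measured as $\tilde y_t=y_t+\varepsilon_t$ with $\|\varepsilon_t\|_\infty\le\bar\varepsilon$. Put $\xi_t=(u_{[t-n,t-1]},y_{[t-n,t-1]})$ and $\tilde\xi_t=(u_{[t-n,t-1]},\tilde y_{[t-n,t-1]})$. Let $J_L^*(\tilde\xi_t)\in[0,\infty]$ be the optimal value ($\infty$ if infeasible) of the problem to minimize, over $\alpha\in\mathbb R^{N-L-n+1}$ and $\sigma_k,\bar y_k\in\mathbb R^p$, $\bar u_k\in\mathbb R^m$ ($-n\le k\le L-1$), $$\sum_{k=0}^{L-1}\bigl(\|\bar u_k\|_R^2+\|\bar y_k\|_Q^2\bigr)+\lambda_\alpha\bar\varepsilon\|\alpha\|_2^2+\lambda_\sigma\|\sigma\|_2^2$$ subject to $\bar u=H_{L+n}(u^d)\alpha$, $\bar y+\sigma=H_{L+n}(\tilde y^d)\alpha$; $(\bar u_{[-n,-1]},\bar y_{[-n,-1]})=\tilde\xi_t$; $\bar u_k=0$ and $\bar y_k=0$ for $L-n\le k\le L-1$; and $\bar u_k\in\mathbb U$, $\|\sigma_k\|_\infty\le\bar\varepsilon(1+\|\alpha\|_1)$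 for $0\le k\le L-1$. In the $n$-step scheme, at each sampling time $t=0,n,2n,\dots$ an optimal solution is computed and $u_{t+k}=\bar u_k^*(t)$ is applied for $0\le k<n$. *Lyapunov function.* A matrix $P\succ0$ with constants $c_1,c_2>0$ is called an IOSS Lyapunov function if, along all trajectories of the system, $$\|\xi_{t+1}\|_P^2-\|\xi_t\|_P^2\le-\tfrac12\|\xi_t\|_2^2+c_1\|u_t\|_2^2+c_2\|y_t\|_2^2 .$$ For $\gamma>0$ put $V_t=J_L^*(\tilde\xi_t)+\gamma\|\xi_t\|_P^2$. **Theorem.** An IOSS Lyapunov function exists. Let $(P,c_1,c_2)$ be any IOSS Lyapunov function and let $\gamma>0$ satisfy $\gamma c_1I\preceq R$ and $2\gamma c_2I\preceq Q$. For every $V_{ROA}>0$ there are constants $0<\underline\lambda_\alpha<\overline\lambda_\alpha$ and $0<\underline\lambda_\sigma<\overline\lambda_\sigma$ such that, for all $\lambda_\alpha\in[\underline\lambda_\alpha,\overline\lambda_\alpha]$ and $\lambda_\sigma\in[\underline\lambda_\sigma,\overline\lambda_\sigma]$, there are $\bar\varepsilon_0,\bar c_{pe}>0$, a number $c\in(0,1)$,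 and a continuous, strictly increasing $\beta:[0,\bar\varepsilon_0]\to[0,V_{ROA}]$ with $\beta(0)=0$, such that the following holds for every noise level $0<\bar\varepsilon\le\bar\varepsilon_0$, all data as above with $c_{pe}\bar\varepsilon\le\bar c_{pe}$, all online noise bounded by $\bar\varepsilon$, and every $K\ge 0$. Whenever the system has been run for $K$ steps of the $n$-step scheme, starting with $V_0\le V_{ROA}$, then 1. $V_{Kn}\le V_{ROA}$ (the sublevel set is invariant; in particular the optimization problem at time $Kn$ is feasible); 2. $V_{Kn}\le\beta(\bar\varepsilon)+c^K\max\{V_0-\beta(\bar\varepsilon),0\}$ (exponential convergence to $\{V\le\beta(\bar\varepsilon)\}$); 3. if $\mathbb U$ is closed, the optimization problem at time $Kn$ has an optimal solution, so that the scheme can be continued. -/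

import Mathlib

namespace DDMPC

/-- Squared Euclidean norm `‖v‖₂²` of a coordinate vector. -/
def sqNorm {ι : Type*} [Fintype ι] (v : ι → ℝ) : ℝ := ∑ i, v i ^ 2

/-- Squared weighted norm `‖v‖_P² = vᵀ P v`. -/
def wNorm {ι : Type*} [Fintype ι] (P : Matrix ι ι ℝ) (v : ι → ℝ) : ℝ :=
  dotProduct v (Matrix.mulVec P v)

/-- The `ℓ₁`-norm of a coordinate vector. -/
def l1Norm {ι : Type*} [Fintype ι] (v : ι → ℝ) : ℝ := ∑ i, |v i|

/-- State-space matrices of a discrete-time LTI system with `n` states, `m` inputs, `p` outputs. -/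
structure LTI (n m p : ℕ) where
  A : Matrix (Fin n) (Fin n) ℝ
  B : Matrix (Fin n) (Fin m) ℝ
  C : Matrix (Fin p) (Fin n) ℝ
  D : Matrix (Fin p) (Fin m) ℝ

namespace LTI

variable {n m p : ℕ}

/-- `[B, AB, …, A^(n-1) B]`. -/
def controllabilityMatrix (G : LTI n m p) : Matrix (Fin n) (Fin n × Fin m) ℝ :=
  Matrix.of fun i kj => (G.A ^ (kj.1 : ℕ) * G.B) i kj.2

/-- The stacked matrix with blocks `C, CA, …, C A^(n-1)`. -/
def observabilityMatrix (G : LTI n m p) : Matrix (Fin n × Fin p) (Fin n) ℝ :=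
  Matrix.of fun ka j => (G.C * G.A ^ (ka.1 : ℕ)) ka.2 j

/-- Minimality of a realization: it is controllable and observable. -/
def IsMinimal (G : LTI n m p) : Prop :=
  G.controllabilityMatrix.rank = n ∧ G.observabilityMatrix.rank = n

/-- The dynamics `x⁺ = A x + B u`, `y = C x + D u` hold at time `k`. -/
def StepAt (G : LTI n m p) (u : ℕ → Fin m → ℝ) (x : ℕ → Fin n → ℝ) (y : ℕ → Fin p → ℝ)
    (k : ℕ) : Prop :=
  x (k + 1) = Matrix.mulVec G.A (x k) + Matrix.mulVec G.B (u k) ∧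
    y k = Matrix.mulVec G.C (x k) + Matrix.mulVec G.D (u k)

end LTI

/-- The block Hankel matrix `H_d(v)` of the sequence `v_0, …, v_{N-1}`: it has `d` block rows,
`N - d + 1` columns (none if `d > N`), and `v_{i+j}` as its `(i, j)` block. -/
def hankel {q : ℕ} (d N : ℕ) (v : ℕ → Fin q → ℝ) :
    Matrix (Fin d × Fin q) (Fin (N + 1 - d)) ℝ :=
  Matrix.of fun ia j => v ((ia.1 : ℕ) + (j : ℕ)) ia.2

/-- `v_0, …, v_{N-1}` is persistently exciting of order `d`. -/
def PersistentlyExciting {q : ℕ} (d N : ℕ) (v : ℕ → Fin q → ℝ) : Prop :=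
  (hankel d N v).rank = q * d

/-- The matrix `H_ux`, with the Hankel matrix of depth `n + L` of the input data on top of
the row of the states `x_0, …, x_{N-L-n}`. -/
def Hux {n m : ℕ} (L N : ℕ) (ud : ℕ → Fin m → ℝ) (xd : ℕ → Fin n → ℝ) :
    Matrix ((Fin (n + L) × Fin m) ⊕ Fin n) (Fin (N + 1 - (n + L))) ℝ :=
  Matrix.fromRows (hankel (n + L) N ud) (Matrix.of fun a j => xd (j : ℕ) a)

open scoped Matrix.Norms.L2Operator in
/-- `c_pe = ‖H†‖₂²`, where `H† = Hᵀ (H Hᵀ)⁻¹` is the right inverse of `H = H_ux` and the norm is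
the spectral norm. -/
noncomputable def cpe {n m : ℕ} (L N : ℕ) (ud : ℕ → Fin m → ℝ) (xd : ℕ → Fin n → ℝ) : ℝ :=
  ‖(Hux L N ud xd).transpose * (Hux L N ud xd * (Hux L N ud xd).transpose)⁻¹‖ ^ 2

/-- The stacked window `v_{[s, s+n-1]}`. -/
def window {q : ℕ} (n : ℕ) (v : ℕ → Fin q → ℝ) (s : ℕ) : Fin n → Fin q → ℝ :=
  fun i => v (s + (i : ℕ))

/-- The extended state `ξ`: `n` inputs stacked on top of `n` outputs. -/
def stack {n m p : ℕ} (u : Fin n → Fin m → ℝ) (y : Fin n → Fin p → ℝ) :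
    (Fin n × Fin m) ⊕ (Fin n × Fin p) → ℝ :=
  Sum.elim (fun a => u a.1 a.2) (fun b => y b.1 b.2)

/-- `W(ξ) = ‖ξ‖_P²` is an input-output-to-state stability Lyapunov function, with gains
`c₁, c₂ > 0`, of `G` with respect to the extended state `ξ`:
`W(ξ_{t+1}) - W(ξ_t) ≤ -½ ‖ξ_t‖₂² + c₁ ‖u_t‖₂² + c₂ ‖y_t‖₂²` along the trajectories of `G`
(written here at `t = n`, with the trajectory starting at time `0`). -/
def IsIOSS {n m p : ℕ} (G : LTI n m p)
    (P : Matrix ((Fin n × Fin m) ⊕ (Fin n × Fin p)) ((Fin n × Fin m) ⊕ (Fin n × Fin p)) ℝ)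
    (c₁ c₂ : ℝ) : Prop :=
  P.PosDef ∧ 0 < c₁ ∧ 0 < c₂ ∧
  ∀ (u : ℕ → Fin m → ℝ) (x : ℕ → Fin n → ℝ) (y : ℕ → Fin p → ℝ),
    (∀ k ≤ n, G.StepAt u x y k) →
    wNorm P (stack (window n u 1) (window n y 1)) - wNorm P (stack (window n u 0) (window n y 0))
      ≤ -(1 / 2) * sqNorm (stack (window n u 0) (window n y 0))
        + c₁ * sqNorm (u n) + c₂ * sqNorm (y n)

/-- The data of the robust MPC problem: weights `Q, R` of the stage cost, input constraint set
`U`, regularization weights `lα, lσ`, noise level `εbar`, input data `ud` and noisy output data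
`yd` (only the entries with index below `N` are used). -/
structure Scheme (m p : ℕ) where
  Q : Matrix (Fin p) (Fin p) ℝ
  R : Matrix (Fin m) (Fin m) ℝ
  U : Set (Fin m → ℝ)
  lα : ℝ
  lσ : ℝ
  εbar : ℝ
  ud : ℕ → Fin m → ℝ
  yd : ℕ → Fin p → ℝ

/-- The decision variables. Prediction time `k ∈ {-n, …, L-1}` has position `n + k` in
`Fin (n + L)`: `Fin.castAdd L i` is the prediction time `i - n` (for `i < n`), and
`Fin.natAdd n k` is the prediction time `k` (for `0 ≤ k < L`). -/
structure Decision (n m p L N : ℕ) where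
  α : Fin (N + 1 - (n + L)) → ℝ
  σ : Fin (n + L) → Fin p → ℝ
  ubar : Fin (n + L) → Fin m → ℝ
  ybar : Fin (n + L) → Fin p → ℝ

namespace Scheme

variable {n m p L N : ℕ}

/-- The open-loop cost: the sum of the stage costs `‖ū_k‖_R² + ‖ȳ_k‖_Q²` over `0 ≤ k < L`, plus
`lα εbar ‖α‖₂² + lσ ‖σ‖₂²`. -/
noncomputable def cost (S : Scheme m p) (z : Decision n m p L N) : ℝ :=
  (∑ k : Fin L, (wNorm S.R (z.ubar (Fin.natAdd n k)) + wNorm S.Q (z.ybar (Fin.natAdd n k))))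
    + S.lα * S.εbar * sqNorm z.α + S.lσ * ∑ i, sqNorm (z.σ i)

/-- The constraints, given the past `n` inputs and the past `n` (noisy) measured outputs. -/
structure Feasible (S : Scheme m p) (upast : Fin n → Fin m → ℝ) (ypast : Fin n → Fin p → ℝ)
    (z : Decision n m p L N) : Prop where
  input_model : ∀ i a, z.ubar i a = Matrix.mulVec (hankel (n + L) N S.ud) z.α (i, a)
  output_model : ∀ i a, z.ybar i a + z.σ i a = Matrix.mulVec (hankel (n + L) N S.yd) z.α (i, a)
  input_init : ∀ i : Fin n, z.ubar (Fin.castAdd L i) = upast i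
  output_init : ∀ i : Fin n, z.ybar (Fin.castAdd L i) = ypast i
  terminal : ∀ k : Fin L, L ≤ (k : ℕ) + n →
    z.ubar (Fin.natAdd n k) = 0 ∧ z.ybar (Fin.natAdd n k) = 0
  input_constraint : ∀ k : Fin L, z.ubar (Fin.natAdd n k) ∈ S.U
  slack : ∀ (k : Fin L) (a : Fin p), |z.σ (Fin.natAdd n k) a| ≤ S.εbar * (1 + l1Norm z.α)

/-- `z` is an optimal solution of the MPC problem. -/
def IsOptimal (S : Scheme m p) (upast : Fin n → Fin m → ℝ) (ypast : Fin n → Fin p → ℝ)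
    (z : Decision n m p L N) : Prop :=
  S.Feasible upast ypast z ∧
    ∀ w : Decision n m p L N, S.Feasible upast ypast w → S.cost z ≤ S.cost w

/-- The optimal cost `J_L^*`, equal to `⊤` exactly when the problem is infeasible. -/
noncomputable def optCost (S : Scheme m p) (L N : ℕ) (upast : Fin n → Fin m → ℝ)
    (ypast : Fin n → Fin p → ℝ) : EReal :=
  ⨅ (z : Decision n m p L N) (_ : S.Feasible upast ypast z), ((S.cost z : ℝ) : EReal)

/-- The Lyapunov function candidate `V = J_L^*(ξ̃) + γ ‖ξ‖_P²` for the sampling instant whose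
past window occupies the positions `s, …, s + n - 1` of the input `u`, the output `y` and the
measurement noise `ε`. -/
noncomputable def V (S : Scheme m p) (L N : ℕ) (γ : ℝ)
    (P : Matrix ((Fin n × Fin m) ⊕ (Fin n × Fin p)) ((Fin n × Fin m) ⊕ (Fin n × Fin p)) ℝ)
    (u : ℕ → Fin m → ℝ) (y ε : ℕ → Fin p → ℝ) (s : ℕ) : EReal :=
  S.optCost L N (window n u s) (window n (y + ε) s)
    + ((γ * wNorm P (stack (window n u s) (window n y s)) : ℝ) : EReal)

/-- The `j`-th step of the `n`-step MPC scheme. Positions in the sequences are shifted by `n`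
against time, so that the past window of the `j`-th sampling instant `t = j n` occupies the
positions `j n, …, j n + n - 1`. The problem is solved for the measured past, and the first `n`
inputs of an optimal solution are applied over the next `n` time steps. -/
def MPCStep (S : Scheme m p) (n L N : ℕ) (u : ℕ → Fin m → ℝ) (y ε : ℕ → Fin p → ℝ)
    (j : ℕ) : Prop :=
  ∃ z : Decision n m p L N,
    S.IsOptimal (window n u (j * n)) (window n (y + ε) (j * n)) z ∧
    ∀ k : Fin L, (k : ℕ) < n → u (j * n + n + (k : ℕ)) = z.ubar (Fin.natAdd n k)

end Scheme

end DDMPC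

/-! Everything rests on a one-step contraction: as long as `V ≤ V_ROA`, one pass of the scheme gives
`V⁺ ≤ (1 - θ) V + M ε̄²` (`exists_contraction`). Iterating it gives the convergence with `c = 1 - θ`
and `β(ε̄) = (M / θ) ε̄²`, and `M ε̄₀² ≤ θ V_ROA` makes the sublevel set invariant.

The contraction compares the optimal solution with a candidate for the next instant
(`exists_step_bound`). Drive the true system with the predicted inputs. Its outputs differ from the
predicted ones only through the slack and the noise amplified by `α`, collected in `mismatch`
(`exists_prediction_error_bound`). The prediction ends with `n` zero inputs and outputs, so by
observability the true state is small there, and a short deadbeat input, small enough to lie in `U`,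
brings it to rest. The shifted trajectory with this tail is an exact trajectory of the system. By
the fundamental lemma (`LTI.eq_zero_of_persistentlyExciting`, `exists_coefficients`) the data
generate it, with coefficients bounded through `c_pe`; hence it is feasible, at a regularization
cost proportional to its energy (`HasData.exists_feasible`).

The shift drops the first `n` stage costs, and these dominate the supply terms in the IOSS
inequality for `γ ‖ξ‖_P²`. What remains is a decrease of `γ/2 ‖ξ‖²` plus the regularization of the
old solution. The latter pays for the mismatch when `λ_σ` is large and `ε̄` small. The former pays
for the Young remainder and for the regularization of the candidate when `c_pe ε̄` is small, and
still yields contraction, because `V ≤ C_V ‖ξ‖² + O(ε̄²)`: near the origin by a deadbeat candidate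
(`exists_local_bound`), elsewhere because `V ≤ V_ROA`.

Optimal solutions exist because the regularization makes the cost coercive (`exists_optimal`). -/

namespace DDMPC

/-! ### Quadratic norms and matrix bounds -/

section Norms

variable {ι κ : Type*} [Fintype ι] [Fintype κ]

lemma sqNorm_nonneg (v : ι → ℝ) : 0 ≤ sqNorm v := Finset.sum_nonneg fun _ _ => sq_nonneg _

lemma sqNorm_zero : sqNorm (0 : ι → ℝ) = 0 := by simp [sqNorm]

lemma sqNorm_add_le (v w : ι → ℝ) : sqNorm (v + w) ≤ 2 * sqNorm v + 2 * sqNorm w := by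
  simp only [sqNorm, Finset.mul_sum, ← Finset.sum_add_distrib, Pi.add_apply]
  exact Finset.sum_le_sum fun i _ => by nlinarith [sq_nonneg (v i - w i)]

lemma sqNorm_sub_le (v w : ι → ℝ) : sqNorm (v - w) ≤ 2 * sqNorm v + 2 * sqNorm w := by
  simp only [sqNorm, Finset.mul_sum, ← Finset.sum_add_distrib, Pi.sub_apply]
  exact Finset.sum_le_sum fun i _ => by nlinarith [sq_nonneg (v i + w i)]

lemma sqNorm_le_of_abs_le {v : ι → ℝ} {c : ℝ} (h : ∀ i, |v i| ≤ c) :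
    sqNorm v ≤ Fintype.card ι * c ^ 2 := by
  have : ∀ i ∈ Finset.univ, v i ^ 2 ≤ c ^ 2 := fun i _ => by
    rw [← sq_abs]; exact pow_le_pow_left₀ (abs_nonneg _) (h i) 2
  simpa [sqNorm] using Finset.sum_le_card_nsmul Finset.univ _ _ this

lemma sq_le_sqNorm (v : ι → ℝ) (i : ι) : v i ^ 2 ≤ sqNorm v :=
  Finset.single_le_sum (f := fun i => v i ^ 2) (fun _ _ => sq_nonneg _) (Finset.mem_univ i)

lemma sqNorm_sumElim (v : ι → ℝ) (w : κ → ℝ) :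
    sqNorm (Sum.elim v w) = sqNorm v + sqNorm w := by
  simp [sqNorm]

lemma sqNorm_prod (v : ι → κ → ℝ) :
    sqNorm (fun a : ι × κ => v a.1 a.2) = ∑ i, sqNorm (v i) := by
  simp [sqNorm, Fintype.sum_prod_type]

lemma l1Norm_nonneg (v : ι → ℝ) : 0 ≤ l1Norm v := Finset.sum_nonneg fun _ _ => abs_nonneg _

lemma l1Norm_sq_le (v : ι → ℝ) : l1Norm v ^ 2 ≤ Fintype.card ι * sqNorm v := by
  have := sq_sum_le_card_mul_sum_sq (s := Finset.univ) (f := fun i => |v i|)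
  simpa [l1Norm, sqNorm] using this

lemma exists_sqNorm_mulVec_le (M : Matrix κ ι ℝ) :
    ∃ C : ℝ, 0 < C ∧ ∀ v, sqNorm (M.mulVec v) ≤ C * sqNorm v := by
  refine ⟨∑ i, ∑ j, M i j ^ 2 + 1, by positivity, fun v => ?_⟩
  have h : sqNorm (M.mulVec v) ≤ (∑ i, ∑ j, M i j ^ 2) * sqNorm v := by
    rw [Finset.sum_mul]
    exact Finset.sum_le_sum fun i _ => Finset.sum_mul_sq_le_sq_mul_sq _ _ _
  nlinarith [sqNorm_nonneg v]

lemma exists_wNorm_le (M : Matrix ι ι ℝ) :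
    ∃ C : ℝ, 0 < C ∧ ∀ v, wNorm M v ≤ C * sqNorm v := by
  obtain ⟨C, hC, h⟩ := exists_sqNorm_mulVec_le M
  refine ⟨1 + C, by positivity, fun v => ?_⟩
  have h1 : wNorm M v ≤ sqNorm v + sqNorm (M.mulVec v) := by
    simp only [wNorm, dotProduct, sqNorm, ← Finset.sum_add_distrib]
    exact Finset.sum_le_sum fun i _ => by
      nlinarith [sq_nonneg (v i - M.mulVec v i), sq_nonneg (v i), sq_nonneg (M.mulVec v i)]
  linarith [h v]

lemma wNorm_nonneg {M : Matrix ι ι ℝ} (hM : M.PosDef) (v : ι → ℝ) : 0 ≤ wNorm M v := by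
  simpa [wNorm] using hM.posSemidef.dotProduct_mulVec_nonneg v

lemma wNorm_zero (M : Matrix ι ι ℝ) : wNorm M 0 = 0 := by simp [wNorm]

/-- Young's inequality, by expanding the square of `η • v - w`. A small `η` keeps the factor of the
main term close to one, so that only a small part of the decrease is lost. -/
lemma wNorm_add_le {M : Matrix ι ι ℝ} (hM : M.PosDef) (v w : ι → ℝ) {η : ℝ} (hη : 0 < η) :
    wNorm M (v + w) ≤ (1 + η) * wNorm M v + (1 + η⁻¹) * wNorm M w := by
  have h := wNorm_nonneg hM (η • v - w)
  have h2 : η⁻¹ * wNorm M (η • v - w) =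
      (1 + η) * wNorm M v + (1 + η⁻¹) * wNorm M w - wNorm M (v + w) := by
    simp only [wNorm, Matrix.mulVec_sub, Matrix.mulVec_add, Matrix.mulVec_smul, dotProduct_sub,
      sub_dotProduct, dotProduct_add, add_dotProduct, smul_dotProduct, dotProduct_smul,
      smul_eq_mul]
    field_simp
    ring
  have := mul_nonneg (inv_pos.2 hη).le h
  linarith

lemma mulVec_injective_of_rank {κ' : Type*} {M : Matrix κ' ι ℝ} (h : M.rank = Fintype.card ι) :
    Function.Injective M.mulVec := by
  have h1 := M.mulVecLin.finrank_range_add_finrank_ker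
  rw [Module.finrank_fintype_fun_eq_card] at h1
  have h2 : Module.finrank ℝ (LinearMap.ker M.mulVecLin) = 0 := by
    have : Module.finrank ℝ (LinearMap.range M.mulVecLin) = Fintype.card ι := h
    omega
  have h3 := LinearMap.ker_eq_bot.1 (Submodule.finrank_eq_zero.1 h2)
  exact h3

lemma isUnit_transpose_mul_self [DecidableEq ι] {M : Matrix κ ι ℝ}
    (h : Function.Injective M.mulVec) : IsUnit (M.transpose * M) := by
  rw [← Matrix.mulVec_injective_iff_isUnit]
  intro v w hvw
  apply h
  have h0 : (M.transpose * M).mulVec (v - w) = 0 := by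
    rw [Matrix.mulVec_sub]; exact sub_eq_zero.2 hvw
  have h1 : M.mulVec (v - w) = 0 := by
    have := (Matrix.conjTranspose_mul_self_mulVec_eq_zero M (v - w)).1
    simp only [Matrix.conjTranspose_eq_transpose_of_trivial] at this
    exact this h0
  rw [Matrix.mulVec_sub] at h1
  exact sub_eq_zero.1 h1

/-- Full column rank provides the bounded left inverse `(Mᵀ M)⁻¹ Mᵀ`. This turns observability into
an estimate. -/
lemma exists_sqNorm_le_mulVec {M : Matrix κ ι ℝ} (h : M.rank = Fintype.card ι) :
    ∃ C : ℝ, 0 < C ∧ ∀ v, sqNorm v ≤ C * sqNorm (M.mulVec v) := by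
  classical
  have hu := isUnit_transpose_mul_self (mulVec_injective_of_rank h)
  obtain ⟨C, hC, hb⟩ := exists_sqNorm_mulVec_le ((M.transpose * M)⁻¹ * M.transpose)
  refine ⟨C, hC, fun v => ?_⟩
  have := hb (M.mulVec v)
  rwa [Matrix.mulVec_mulVec, Matrix.mul_assoc,
    Matrix.nonsing_inv_mul _ ((Matrix.isUnit_iff_isUnit_det _).1 hu), Matrix.one_mulVec] at this

/-- The dual device, with `Mᵀ (M Mᵀ)⁻¹`: it turns controllability into an input of controlled size.
-/
lemma exists_right_inverse_bound {M : Matrix κ ι ℝ} (h : M.rank = Fintype.card κ) :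
    ∃ C : ℝ, 0 < C ∧ ∀ w, ∃ v, M.mulVec v = w ∧ sqNorm v ≤ C * sqNorm w := by
  classical
  have hr : M.transpose.rank = Fintype.card κ := by rw [Matrix.rank_transpose, h]
  have hu := isUnit_transpose_mul_self (mulVec_injective_of_rank hr)
  rw [Matrix.transpose_transpose] at hu
  obtain ⟨C, hC, hb⟩ := exists_sqNorm_mulVec_le (M.transpose * (M * M.transpose)⁻¹)
  refine ⟨C, hC, fun w => ⟨_, ?_, hb w⟩⟩
  rw [Matrix.mulVec_mulVec, ← Matrix.mul_assoc,
    Matrix.mul_nonsing_inv _ ((Matrix.isUnit_iff_isUnit_det _).1 hu), Matrix.one_mulVec]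

open scoped Matrix.Norms.L2Operator in
lemma sqNorm_mulVec_le_opNorm [DecidableEq ι] (M : Matrix κ ι ℝ) (v : ι → ℝ) :
    sqNorm (M.mulVec v) ≤ ‖M‖ ^ 2 * sqNorm v := by
  have h := Matrix.l2_opNorm_mulVec M (WithLp.toLp 2 v)
  have h2 := pow_le_pow_left₀ (norm_nonneg _) h 2
  rw [mul_pow, EuclideanSpace.norm_sq_eq, EuclideanSpace.norm_sq_eq] at h2
  simpa [sqNorm] using h2

end Norms

end DDMPC

/-! ### Finite-horizon estimates: response, observability, deadbeat control -/

namespace DDMPC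

namespace LTI

variable {n m p : ℕ} (G : LTI n m p)

/-- The state response to the input `u` from the initial state `x₀`. -/
def state (x₀ : Fin n → ℝ) (u : ℕ → Fin m → ℝ) : ℕ → Fin n → ℝ
  | 0 => x₀
  | k + 1 => G.A.mulVec (state x₀ u k) + G.B.mulVec (u k)

/-- The output response to the input `u` from the initial state `x₀`. -/
def output (x₀ : Fin n → ℝ) (u : ℕ → Fin m → ℝ) (k : ℕ) : Fin p → ℝ :=
  G.C.mulVec (G.state x₀ u k) + G.D.mulVec (u k)

lemma stepAt_state (x₀ : Fin n → ℝ) (u : ℕ → Fin m → ℝ) (k : ℕ) :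
    G.StepAt u (G.state x₀ u) (G.output x₀ u) k := ⟨rfl, rfl⟩

variable {G}

lemma StepAt.sub {u u' : ℕ → Fin m → ℝ} {x x' : ℕ → Fin n → ℝ} {y y' : ℕ → Fin p → ℝ} {k : ℕ}
    (h : G.StepAt u x y k) (h' : G.StepAt u' x' y' k) :
    G.StepAt (fun k => u k - u' k) (fun k => x k - x' k) (fun k => y k - y' k) k := by
  constructor
  · change x (k + 1) - x' (k + 1) = _
    rw [h.1, h'.1, Matrix.mulVec_sub, Matrix.mulVec_sub]; abel
  · change y k - y' k = _
    rw [h.2, h'.2, Matrix.mulVec_sub, Matrix.mulVec_sub]; abel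

lemma StepAt.shift {u : ℕ → Fin m → ℝ} {x : ℕ → Fin n → ℝ} {y : ℕ → Fin p → ℝ} {s k : ℕ}
    (h : G.StepAt u x y (s + k)) :
    G.StepAt (fun k => u (s + k)) (fun k => x (s + k)) (fun k => y (s + k)) k := h

lemma output_eq_of_input_zero {u : ℕ → Fin m → ℝ} {x : ℕ → Fin n → ℝ} {y : ℕ → Fin p → ℝ}
    {T : ℕ} (h : ∀ k < T, G.StepAt u x y k) (hu : ∀ k < T, u k = 0) :
    ∀ k < T, x k = (G.A ^ k).mulVec (x 0) ∧ y k = (G.C * G.A ^ k).mulVec (x 0) := by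
  have hx : ∀ k < T, x k = (G.A ^ k).mulVec (x 0) := by
    intro k
    induction k with
    | zero => intro; simp
    | succ k ih =>
      intro hk
      rw [(h k (by omega)).1, hu k (by omega), ih (by omega), Matrix.mulVec_mulVec, pow_succ']
      simp
  intro k hk
  refine ⟨hx k hk, ?_⟩
  rw [(h k hk).2, hu k hk, hx k hk, Matrix.mulVec_mulVec]
  simp

lemma eq_state {u u' : ℕ → Fin m → ℝ} {x : ℕ → Fin n → ℝ} {y : ℕ → Fin p → ℝ}
    {T : ℕ} (h : ∀ k < T, G.StepAt u x y k) (hu : ∀ k < T, u' k = u k) :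
    (∀ k ≤ T, G.state (x 0) u' k = x k) ∧ ∀ k < T, G.output (x 0) u' k = y k := by
  have hx : ∀ k ≤ T, G.state (x 0) u' k = x k := by
    intro k
    induction k with
    | zero => intro; rfl
    | succ k ih =>
      intro hk
      rw [state, ih (by omega), hu k (by omega), (h k (by omega)).1]
  refine ⟨hx, fun k hk => ?_⟩
  rw [output, hx k hk.le, hu k hk, (h k hk).2]

variable (G)

/-- States and outputs over a finite horizon are bounded by the initial state and the inputs. -/
lemma exists_response_bound (T : ℕ) : ∃ C : ℝ, 0 < C ∧ ∀ (u : ℕ → Fin m → ℝ)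
    (x : ℕ → Fin n → ℝ) (y : ℕ → Fin p → ℝ), (∀ k < T, G.StepAt u x y k) →
    (∀ k ≤ T, sqNorm (x k) ≤ C * (sqNorm (x 0) + ∑ i ∈ Finset.range T, sqNorm (u i))) ∧
    ∀ k < T, sqNorm (y k) ≤ C * (sqNorm (x 0) + ∑ i ∈ Finset.range T, sqNorm (u i)) := by
  obtain ⟨a, ha, hA⟩ := exists_sqNorm_mulVec_le G.A
  obtain ⟨b, hb, hB⟩ := exists_sqNorm_mulVec_le G.B
  obtain ⟨c, hc, hC⟩ := exists_sqNorm_mulVec_le G.C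
  obtain ⟨d, hd, hD⟩ := exists_sqNorm_mulVec_le G.D
  have hx : ∃ K : ℝ, 0 < K ∧ ∀ (u : ℕ → Fin m → ℝ)
      (x : ℕ → Fin n → ℝ) (y : ℕ → Fin p → ℝ), (∀ k < T, G.StepAt u x y k) →
      (∀ k ≤ T, sqNorm (x k) ≤ K * (sqNorm (x 0) + ∑ i ∈ Finset.range T, sqNorm (u i))) := by
    induction T with
    | zero =>
      refine ⟨1, one_pos, fun u x y _ k hk => ?_⟩
      obtain rfl : k = 0 := by omega
      simp
    | succ T ih =>
      obtain ⟨K, hK, hx⟩ := ih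
      refine ⟨K + 2 * a * K + 2 * b, by positivity, fun u x y h k hk => ?_⟩
      have hx' := hx u x y (fun k hk => h k (by omega))
      have h0 := sqNorm_nonneg (x 0)
      have h1 : 0 ≤ ∑ i ∈ Finset.range T, sqNorm (u i) :=
        Finset.sum_nonneg fun _ _ => sqNorm_nonneg _
      have h2 := sqNorm_nonneg (u T)
      rw [Finset.sum_range_succ]
      rcases Nat.lt_or_ge k (T + 1) with hk' | hk'
      · have := hx' k (by omega)
        have h3 : 0 ≤ 2 * a * K + 2 * b := by positivity
        nlinarith [mul_nonneg h3 (add_nonneg h0 (add_nonneg h1 h2)), mul_nonneg hK.le h2]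
      · obtain rfl : k = T + 1 := by omega
        rw [(h T (by omega)).1]
        have e1 := sqNorm_add_le (G.A.mulVec (x T)) (G.B.mulVec (u T))
        have e2 := hA (x T)
        have e3 := hB (u T)
        have e4 := mul_le_mul_of_nonneg_left (hx' T le_rfl) ha.le
        have e5 : 0 ≤ K * (sqNorm (x 0) + ∑ i ∈ Finset.range T, sqNorm (u i)) := by positivity
        have e6 : 0 ≤ 2 * b * (sqNorm (x 0) + ∑ i ∈ Finset.range T, sqNorm (u i)) := by
          positivity
        have e7 : 0 ≤ (K + 2 * a * K) * sqNorm (u T) := by positivity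
        linarith
  obtain ⟨K, hK, hx⟩ := hx
  refine ⟨K + 2 * c * K + 2 * d, by positivity, fun u x y h => ?_⟩
  have h0 := sqNorm_nonneg (x 0)
  have h1 : 0 ≤ ∑ i ∈ Finset.range T, sqNorm (u i) :=
    Finset.sum_nonneg fun _ _ => sqNorm_nonneg _
  set S := sqNorm (x 0) + ∑ i ∈ Finset.range T, sqNorm (u i) with hS
  have hS0 : 0 ≤ S := by positivity
  have hx' := hx u x y h
  constructor
  · intro k hk
    have := hx' k hk
    have h3 : 0 ≤ (2 * c * K + 2 * d) * S := by positivity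
    linarith
  · intro k hk
    rw [(h k hk).2]
    have e1 := sqNorm_add_le (G.C.mulVec (x k)) (G.D.mulVec (u k))
    have e2 := hC (x k)
    have e3 := hD (u k)
    have e4 := mul_le_mul_of_nonneg_left (hx' k hk.le) hc.le
    have e5 : sqNorm (u k) ≤ S := by
      have := Finset.single_le_sum (f := fun i => sqNorm (u i)) (fun i _ => sqNorm_nonneg _)
        (Finset.mem_range.2 hk)
      linarith
    have e6 := mul_le_mul_of_nonneg_left e5 hd.le
    have e7 : 0 ≤ K * S := by positivity
    linarith

/-- Subtracting the zero-state response leaves a free response, whose first `n` outputs are the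
observability matrix applied to `x 0`. -/
lemma exists_observability_bound (hG : G.observabilityMatrix.rank = n) :
    ∃ C : ℝ, 0 < C ∧ ∀ (u : ℕ → Fin m → ℝ)
    (x : ℕ → Fin n → ℝ) (y : ℕ → Fin p → ℝ), (∀ k < n, G.StepAt u x y k) →
    sqNorm (x 0) ≤ C * ∑ i ∈ Finset.range n, (sqNorm (u i) + sqNorm (y i)) := by
  obtain ⟨K, hK, hO⟩ := exists_sqNorm_le_mulVec (M := G.observabilityMatrix) (by simpa using hG)
  obtain ⟨C, hC, hr⟩ := G.exists_response_bound n
  refine ⟨K * (2 + n * (2 * C)), by positivity, fun u x y h => ?_⟩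
  set y' := G.output 0 u
  have hy' := (hr u _ _ (fun k _ => G.stepAt_state 0 u k)).2
  have hz := output_eq_of_input_zero (fun k hk => (h k hk).sub (G.stepAt_state 0 u k))
    (fun k _ => sub_self _)
  have h1 : sqNorm (G.observabilityMatrix.mulVec (x 0)) =
      ∑ i ∈ Finset.range n, sqNorm (y i - y' i) := by
    rw [Finset.sum_range, ← sqNorm_prod (fun i : Fin n => y i - y' i)]
    congr 1
    funext ⟨k, a⟩
    have := congrFun (hz k k.2).2 a
    simp only [state, sub_zero] at this
    exact this.symm
  have hyb : ∑ i ∈ Finset.range n, sqNorm (y i - y' i) ≤ ∑ i ∈ Finset.range n,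
      (2 * sqNorm (y i) + 2 * (C * ∑ j ∈ Finset.range n, sqNorm (u j))) := by
    refine Finset.sum_le_sum fun i hi => (sqNorm_sub_le _ _).trans ?_
    have := hy' i (Finset.mem_range.1 hi)
    simp only [state, sqNorm_zero, zero_add] at this
    linarith
  have h2 := hO (x 0)
  rw [h1] at h2
  refine h2.trans ?_
  rw [mul_assoc]
  refine mul_le_mul_of_nonneg_left (hyb.trans ?_) hK.le
  rw [Finset.sum_add_distrib, Finset.sum_add_distrib, ← Finset.mul_sum, Finset.sum_const,
    Finset.card_range, nsmul_eq_mul]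
  have hu0 : 0 ≤ ∑ i ∈ Finset.range n, sqNorm (u i) := Finset.sum_nonneg fun _ _ => sqNorm_nonneg _
  have hy0 : 0 ≤ ∑ i ∈ Finset.range n, sqNorm (y i) := Finset.sum_nonneg fun _ _ => sqNorm_nonneg _
  have : 0 ≤ n * (2 * C) * ∑ i ∈ Finset.range n, sqNorm (y i) := by positivity
  linarith

variable {G} in
lemma state_eq_sum (x₀ : Fin n → ℝ) (w : ℕ → Fin m → ℝ) (k : ℕ) :
    G.state x₀ w k = (G.A ^ k).mulVec x₀ +
      ∑ i ∈ Finset.range k, (G.A ^ i * G.B).mulVec (w (k - 1 - i)) := by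
  induction k with
  | zero => simp [state]
  | succ k ih =>
    rw [state, ih, Finset.sum_range_succ', Matrix.mulVec_add, Matrix.mulVec_sum,
      Matrix.mulVec_mulVec, ← pow_succ', ← add_assoc]
    congr 1
    · congr 1
      refine Finset.sum_congr rfl fun i hi => ?_
      rw [Matrix.mulVec_mulVec, ← Matrix.mul_assoc, ← pow_succ']
      congr 2
      omega
    · simp

/-- A preimage of `-A^n x₀` under the controllability matrix is an input whose contribution cancels
the free motion after `n` steps. -/
lemma exists_deadbeat (hG : G.controllabilityMatrix.rank = n) :
    ∃ C : ℝ, 0 < C ∧ ∀ x₀ : Fin n → ℝ, ∃ w : ℕ → Fin m → ℝ,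
      (∀ i, n ≤ i → w i = 0) ∧ G.state x₀ w n = 0 ∧
      ∑ i ∈ Finset.range n, sqNorm (w i) ≤ C * sqNorm x₀ := by
  obtain ⟨K, hK, hc⟩ := exists_right_inverse_bound (M := G.controllabilityMatrix) (by simpa using hG)
  obtain ⟨a, ha, hA⟩ := exists_sqNorm_mulVec_le (-(G.A ^ n))
  refine ⟨K * a, by positivity, fun x₀ => ?_⟩
  obtain ⟨v, hv, hvb⟩ := hc ((-(G.A ^ n)).mulVec x₀)
  let g : ℕ → Fin m → ℝ := fun i => if h : i < n then fun a => v (⟨i, h⟩, a) else 0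
  -- The block of `v` that multiplies `A^i B` must act at time `n - 1 - i`, hence the reversal.
  refine ⟨fun i => if i < n then g (n - 1 - i) else 0, fun i hi => if_neg (by omega), ?_, ?_⟩
  · rw [state_eq_sum]
    have h1 : ∑ i ∈ Finset.range n, (G.A ^ i * G.B).mulVec
        (if n - 1 - i < n then g (n - 1 - (n - 1 - i)) else 0) = G.controllabilityMatrix.mulVec v := by
      rw [Finset.sum_range]
      funext b
      rw [Finset.sum_apply, Matrix.mulVec, dotProduct, Fintype.sum_prod_type]
      refine Finset.sum_congr rfl fun i _ => ?_
      have hi := i.2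
      rw [if_pos (by omega), show n - 1 - (n - 1 - (i : ℕ)) = i by omega]
      simp only [g, hi, dif_pos]
      rfl
    rw [h1, hv, Matrix.neg_mulVec, add_neg_cancel]
  · have h2 : ∑ i ∈ Finset.range n, sqNorm (if i < n then g (n - 1 - i) else 0) = sqNorm v := by
      rw [show sqNorm v = ∑ i : Fin n, sqNorm (fun a => v (i, a)) by
        simp [sqNorm, Fintype.sum_prod_type]]
      rw [← Finset.sum_range_reflect, Finset.sum_range]
      refine Finset.sum_congr rfl fun i _ => ?_
      have hi := i.2
      rw [if_pos (by omega), show n - 1 - (n - 1 - (i : ℕ)) = i by omega]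
      simp only [g, hi, dif_pos]
    rw [h2, mul_assoc]
    exact hvb.trans (mul_le_mul_of_nonneg_left (hA x₀) hK.le)

end LTI

end DDMPC

/-! ### Persistency of excitation and the fundamental lemma -/

namespace DDMPC

variable {n m p : ℕ}

lemma PersistentlyExciting.eq_zero {q d N : ℕ} {v : ℕ → Fin q → ℝ}
    (h : PersistentlyExciting d N v) {θ : ℕ → Fin q → ℝ}
    (hθ : ∀ j, j + d ≤ N → ∑ i ∈ Finset.range d, θ i ⬝ᵥ v (j + i) = 0) :
    ∀ i < d, θ i = 0 := by
  have hr : (hankel d N v).transpose.rank = Fintype.card (Fin d × Fin q) := by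
    rw [Matrix.rank_transpose, h]; simp [mul_comm]
  have hinj := mulVec_injective_of_rank hr
  have h0 : (fun a : Fin d × Fin q => θ a.1 a.2) = 0 := by
    apply hinj
    simp only [Matrix.mulVec_zero]
    funext j
    rw [Pi.zero_apply, ← hθ j (by omega), Finset.sum_range, Matrix.mulVec, dotProduct,
      Fintype.sum_prod_type]
    refine Finset.sum_congr rfl fun i _ => Finset.sum_congr rfl fun a _ => ?_
    simp [hankel, mul_comm, add_comm]
  intro i hi
  funext a
  exact congrFun h0 (⟨i, hi⟩, a)

lemma LTI.vecMul_eq_zero_of_controllable {G : LTI n m p} (hG : G.controllabilityMatrix.rank = n)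
    {ξ : Fin n → ℝ} (h : ∀ k < n, Matrix.vecMul ξ (G.A ^ k * G.B) = 0) : ξ = 0 := by
  have hr : G.controllabilityMatrix.transpose.rank = Fintype.card (Fin n) := by
    rw [Matrix.rank_transpose, hG]; simp
  apply mulVec_injective_of_rank hr
  simp only [Matrix.mulVec_zero, Matrix.mulVec_transpose]
  funext ⟨k, a⟩
  exact congrFun (h k k.2) a

/-- The rank argument behind the fundamental lemma: linear relations between a state and the
subsequent `d` inputs are trivial if the input is persistently exciting of order `d + n`. -/
lemma LTI.eq_zero_of_persistentlyExciting {G : LTI n m p}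
    (hG : G.controllabilityMatrix.rank = n) {N d : ℕ} {u : ℕ → Fin m → ℝ} {x : ℕ → Fin n → ℝ}
    {y : ℕ → Fin p → ℝ} (hstep : ∀ k < N, G.StepAt u x y k)
    (hpe : PersistentlyExciting (d + n) N u) {ξ : Fin n → ℝ} {η : ℕ → Fin m → ℝ}
    (h : ∀ j, j + d ≤ N → ξ ⬝ᵥ x j + ∑ i ∈ Finset.range d, η i ⬝ᵥ u (j + i) = 0) :
    ξ = 0 ∧ ∀ i < d, η i = 0 := by
  -- One sequence encodes all unrolled relations: after `s` substitutions of the dynamics, the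
  -- coefficient of the `q`-th input is `e (q + n - s)`.
  let e : ℕ → Fin m → ℝ := fun t =>
    if t < n then Matrix.vecMul ξ (G.A ^ (n - 1 - t) * G.B) else if t < n + d then η (t - n) else 0
  have shifted : ∀ s ≤ n, ∀ j, j + s + d ≤ N → Matrix.vecMul ξ (G.A ^ s) ⬝ᵥ x j +
      ∑ q ∈ Finset.range (d + s), e (q + n - s) ⬝ᵥ u (j + q) = 0 := by
    intro s
    induction s with
    | zero =>
      intro _ j hj
      rw [← h j (by omega)]
      simp only [pow_zero, Matrix.vecMul_one, add_zero, Nat.sub_zero]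
      congr 1
      refine Finset.sum_congr rfl fun q hq => ?_
      have := Finset.mem_range.1 hq
      simp only [e]
      rw [if_neg (by omega), if_pos (by omega), Nat.add_sub_cancel]
    | succ s ih =>
      intro hs j hj
      have h1 := ih (by omega) (j + 1) (by omega)
      rw [(hstep j (by omega)).1, dotProduct_add, Matrix.dotProduct_mulVec,
        Matrix.dotProduct_mulVec, Matrix.vecMul_vecMul, Matrix.vecMul_vecMul, ← pow_succ] at h1
      rw [← h1, ← add_assoc, Finset.sum_range_succ', add_assoc]
      congr 1
      rw [add_comm]
      congr 1
      · simp only [e]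
        rw [if_pos (by omega), show n - 1 - (0 + n - (s + 1)) = s by omega]
        rfl
      · refine Finset.sum_congr rfl fun q _ => ?_
        rw [show q + 1 + n - (s + 1) = q + n - s by omega, show j + (q + 1) = j + 1 + q by omega]
  -- Padding by zeros brings all relations to the common length `d + n`, so that they can be
  -- combined linearly.
  have hext : ∀ s ≤ n, ∀ j, j + (d + n) ≤ N → Matrix.vecMul ξ (G.A ^ s) ⬝ᵥ x j +
      ∑ q ∈ Finset.range (d + n), e (q + n - s) ⬝ᵥ u (j + q) = 0 := by
    intro s hs j hj
    rw [← shifted s hs j (by omega)]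
    congr 1
    symm
    refine Finset.sum_subset (Finset.range_subset_range.2 (by omega)) fun q _ hq => ?_
    have := Finset.mem_range.not.1 hq
    simp only [e]
    rw [if_neg (by omega), if_neg (by omega), zero_dotProduct]
  set a := G.A.charpoly.coeff with ha
  have hdeg : G.A.charpoly.natDegree = n := by rw [Matrix.charpoly_natDegree_eq_dim]; simp
  have hCH : ∑ s ∈ Finset.range (n + 1), a s • G.A ^ s = 0 := by
    have := Matrix.aeval_self_charpoly G.A
    rwa [Polynomial.aeval_eq_sum_range, hdeg] at this
  have han : a n = 1 := by
    have := G.A.charpoly_monic.coeff_natDegree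
    rwa [hdeg] at this
  -- Weighting the relations by the coefficients of the characteristic polynomial removes the state,
  -- by Cayley–Hamilton. What is left involves `d + n` consecutive inputs only, and persistent
  -- excitation makes it trivial.
  have hθ := hpe.eq_zero (θ := fun q => ∑ s ∈ Finset.range (n + 1), a s • e (q + n - s)) (by
    intro j hj
    have h1 : ∑ s ∈ Finset.range (n + 1), a s * (Matrix.vecMul ξ (G.A ^ s) ⬝ᵥ x j +
      ∑ q ∈ Finset.range (d + n), e (q + n - s) ⬝ᵥ u (j + q)) = 0 :=
      Finset.sum_eq_zero fun s hs => by
        rw [hext s (by have := Finset.mem_range.1 hs; omega) j hj, mul_zero]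
    have h2 : ∑ s ∈ Finset.range (n + 1), a s * (Matrix.vecMul ξ (G.A ^ s) ⬝ᵥ x j) = 0 := by
      have h3 : Matrix.vecMul ξ (∑ s ∈ Finset.range (n + 1), a s • G.A ^ s) ⬝ᵥ x j = 0 := by
        rw [hCH]; simp
      rw [Matrix.vecMul_sum, sum_dotProduct] at h3
      simpa [Matrix.vecMul_smul] using h3
    simp only [mul_add, Finset.sum_add_distrib, h2, zero_add, Finset.mul_sum] at h1
    rw [Finset.sum_comm] at h1
    rw [← h1]
    refine Finset.sum_congr rfl fun q _ => ?_
    rw [sum_dotProduct]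
    exact Finset.sum_congr rfl fun s _ => by rw [smul_dotProduct, smul_eq_mul])
  -- Since the characteristic polynomial is monic, the `t`-th vanishing combination expresses `e t`
  -- through later entries. These vanish from `d + n` on, so the induction runs backwards.
  have he : ∀ r t, d + n - t ≤ r → e t = 0 := by
    intro r
    induction r with
    | zero =>
      intro t ht
      simp only [e]
      rw [if_neg (by omega), if_neg (by omega)]
    | succ r ih =>
      intro t ht
      rcases Nat.lt_or_ge t (d + n) with htn | htn
      · have h1 := hθ t htn
        rw [Finset.sum_range_succ, Finset.sum_eq_zero, zero_add, han, one_smul,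
          Nat.add_sub_cancel] at h1
        · exact h1
        · intro s hs
          have := Finset.mem_range.1 hs
          rw [ih _ (by omega), smul_zero]
      · exact ih t (by omega)
  constructor
  · apply LTI.vecMul_eq_zero_of_controllable hG
    intro k hk
    have h1 := he _ (n - 1 - k) le_rfl
    simp only [e] at h1
    rwa [if_pos (by omega), show n - 1 - (n - 1 - k) = k by omega] at h1
  · intro i hi
    have h1 := he _ (i + n) le_rfl
    simp only [e] at h1
    rwa [if_neg (by omega), if_pos (by omega), Nat.add_sub_cancel] at h1

/-- The combination `∑ⱼ αⱼ v_{·+j}` of the shifts of a sequence. -/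
def comb {q M : ℕ} (v : ℕ → Fin q → ℝ) (α : Fin M → ℝ) (i : ℕ) : Fin q → ℝ :=
  fun a => ∑ j : Fin M, v (i + (j : ℕ)) a * α j

lemma hankel_mulVec {q d N : ℕ} (v : ℕ → Fin q → ℝ) (α : Fin (N + 1 - d) → ℝ) (i : Fin d)
    (a : Fin q) : (hankel d N v).mulVec α (i, a) = comb v α i a := rfl

lemma comb_add {q M : ℕ} (v w : ℕ → Fin q → ℝ) (α : Fin M → ℝ) (i : ℕ) :
    comb (v + w) α i = comb v α i + comb w α i := by
  funext a
  simp [comb, add_mul, Finset.sum_add_distrib]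

lemma mulVec_comb {q r M : ℕ} (F : Matrix (Fin r) (Fin q) ℝ) (v : ℕ → Fin q → ℝ) (α : Fin M → ℝ)
    (i : ℕ) : F.mulVec (comb v α i) = comb (fun k => F.mulVec (v k)) α i := by
  funext a
  simp only [Matrix.mulVec, dotProduct, comb, Finset.mul_sum, Finset.sum_mul]
  rw [Finset.sum_comm]
  exact Finset.sum_congr rfl fun _ _ => Finset.sum_congr rfl fun _ _ => by ring

lemma abs_comb_le {q M N : ℕ} {v : ℕ → Fin q → ℝ} {α : Fin M → ℝ} {i : ℕ} {c : ℝ}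
    (hv : ∀ k < N, ∀ a, |v k a| ≤ c) (hi : ∀ j < M, i + j < N) (a : Fin q) :
    |comb v α i a| ≤ c * l1Norm α := by
  rw [l1Norm, Finset.mul_sum]
  refine (Finset.abs_sum_le_sum_abs _ _).trans (Finset.sum_le_sum fun j _ => ?_)
  rw [abs_mul]
  exact mul_le_mul_of_nonneg_right (hv _ (hi j j.2) a) (abs_nonneg _)

lemma LTI.StepAt.comb {G : LTI n m p} {N M : ℕ} {u : ℕ → Fin m → ℝ} {x : ℕ → Fin n → ℝ}
    {y : ℕ → Fin p → ℝ} (h : ∀ k < N, G.StepAt u x y k) (α : Fin M → ℝ) {i : ℕ}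
    (hi : ∀ j < M, i + j < N) : G.StepAt (comb u α) (comb x α) (comb y α) i := by
  constructor
  · rw [mulVec_comb, mulVec_comb]
    funext a
    simp only [DDMPC.comb, Pi.add_apply, ← Finset.sum_add_distrib, ← add_mul]
    refine Finset.sum_congr rfl fun j _ => ?_
    rw [show i + 1 + (j : ℕ) = i + j + 1 by omega, (h (i + j) (hi j j.2)).1]
    rfl
  · rw [mulVec_comb, mulVec_comb]
    funext a
    simp only [DDMPC.comb, Pi.add_apply, ← Finset.sum_add_distrib, ← add_mul]
    refine Finset.sum_congr rfl fun j _ => ?_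
    rw [(h (i + j) (hi j j.2)).2]
    rfl

lemma cpe_nonneg (L N : ℕ) (ud : ℕ → Fin m → ℝ) (xd : ℕ → Fin n → ℝ) : 0 ≤ cpe L N ud xd :=
  sq_nonneg _

/-- Every input sequence and initial state are generated by the data, with a bound on the
coefficients in terms of `c_pe`. -/
lemma exists_coefficients {G : LTI n m p} (hG : G.controllabilityMatrix.rank = n) {L N : ℕ}
    {ud : ℕ → Fin m → ℝ} {xd : ℕ → Fin n → ℝ} {yd : ℕ → Fin p → ℝ}
    (hstep : ∀ k < N, G.StepAt ud xd yd k) (hpe : PersistentlyExciting (L + 2 * n) N ud)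
    (u : ℕ → Fin m → ℝ) (x₀ : Fin n → ℝ) :
    ∃ α : Fin (N + 1 - (n + L)) → ℝ, (∀ i < n + L, comb ud α i = u i) ∧ comb xd α 0 = x₀ ∧
      sqNorm α ≤ cpe L N ud xd * (∑ i ∈ Finset.range (n + L), sqNorm (u i) + sqNorm x₀) := by
  set H := Hux L N ud xd with hH
  -- Full row rank of `H_ux`: this makes `H Hᵀ` invertible, so that the matrix in `cpe` really is a
  -- right inverse.
  have hinj : Function.Injective H.transpose.mulVec := by
    rw [← Matrix.coe_mulVecLin]
    rw [injective_iff_map_eq_zero]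
    intro w hw
    rw [Matrix.mulVecLin_apply] at hw
    have h1 := LTI.eq_zero_of_persistentlyExciting hG (d := n + L) hstep
      (by rwa [show n + L + n = L + 2 * n by omega]) (ξ := fun b => w (Sum.inr b))
      (η := fun i => if h : i < n + L then fun a => w (Sum.inl (⟨i, h⟩, a)) else 0) (by
        intro j hj
        have h2 : H.transpose.mulVec w ⟨j, by omega⟩ = 0 := by rw [hw]; rfl
        rw [Matrix.mulVec, dotProduct, Fintype.sum_sum_type, Fintype.sum_prod_type] at h2
        rw [← h2, add_comm, Finset.sum_range]
        congr 1
        · refine Finset.sum_congr rfl fun i _ => Finset.sum_congr rfl fun a _ => ?_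
          simp [hH, Hux, hankel, mul_comm, add_comm]
        · refine Finset.sum_congr rfl fun b _ => ?_
          simp [hH, Hux, mul_comm])
    funext b
    rcases b with ⟨i, a⟩ | b
    · have := h1.2 i i.2
      simp only [i.2, dif_pos] at this
      exact congrFun this a
    · exact congrFun h1.1 b
  have hu := isUnit_transpose_mul_self hinj
  rw [Matrix.transpose_transpose] at hu
  set w : (Fin (n + L) × Fin m) ⊕ Fin n → ℝ := Sum.elim (fun a => u a.1 a.2) x₀ with hw
  have hHw : H.mulVec ((H.transpose * (H * H.transpose)⁻¹).mulVec w) = w := by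
    rw [Matrix.mulVec_mulVec, ← Matrix.mul_assoc,
      Matrix.mul_nonsing_inv _ ((Matrix.isUnit_iff_isUnit_det _).1 hu), Matrix.one_mulVec]
  refine ⟨(H.transpose * (H * H.transpose)⁻¹).mulVec w, fun i hi => ?_, ?_, ?_⟩
  · funext a
    exact congrFun hHw (Sum.inl (⟨i, hi⟩, a))
  · funext b
    rw [← show w (Sum.inr b) = x₀ b from rfl, ← congrFun hHw (Sum.inr b)]
    simp [comb, hH, Hux, Matrix.mulVec, dotProduct]
  · have h1 := sqNorm_mulVec_le_opNorm (H.transpose * (H * H.transpose)⁻¹) w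
    have h2 : sqNorm w = ∑ i ∈ Finset.range (n + L), sqNorm (u i) + sqNorm x₀ := by
      rw [hw, sqNorm_sumElim, sqNorm_prod (fun i : Fin (n + L) => u i), Finset.sum_range]
    rw [h2] at h1
    exact h1

end DDMPC

/-! ### Feasible candidates and the prediction error -/

namespace DDMPC

variable {n m p : ℕ}

lemma LTI.state_add (G : LTI n m p) (x₀ : Fin n → ℝ) (u : ℕ → Fin m → ℝ) (s k : ℕ) :
    G.state x₀ u (s + k) = G.state (G.state x₀ u s) (fun k => u (s + k)) k := by
  induction k with
  | zero => rfl
  | succ k ih => rw [← add_assoc, state, state, ih]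

lemma LTI.state_zero (G : LTI n m p) (k : ℕ) : G.state 0 (fun _ => 0) k = 0 := by
  induction k with
  | zero => rfl
  | succ k ih => rw [state, ih]; simp

/-- A trajectory can be continued by a deadbeat input that steers it to the origin. -/
lemma LTI.exists_deadbeat_extension (G : LTI n m p) (hG : G.controllabilityMatrix.rank = n) :
    ∃ C : ℝ, 0 < C ∧ ∀ (u : ℕ → Fin m → ℝ) (x : ℕ → Fin n → ℝ) (y : ℕ → Fin p → ℝ) (s : ℕ),
      (∀ k < s, G.StepAt u x y k) →
      ∃ (u' : ℕ → Fin m → ℝ) (x' : ℕ → Fin n → ℝ) (y' : ℕ → Fin p → ℝ),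
        (∀ k, G.StepAt u' x' y' k) ∧ (∀ k < s, u' k = u k ∧ y' k = y k) ∧ x' 0 = x 0 ∧
        (∀ k, s ≤ k → sqNorm (u' k) ≤ C * sqNorm (x s) ∧ sqNorm (y' k) ≤ C * sqNorm (x s)) ∧
        ∀ k, s + n ≤ k → u' k = 0 ∧ y' k = 0 := by
  obtain ⟨K, hK, hd⟩ := G.exists_deadbeat hG
  obtain ⟨C, hC, hr⟩ := G.exists_response_bound n
  refine ⟨K + C * (1 + K), by positivity, fun u x y s h => ?_⟩
  obtain ⟨w, hw0, hwn, hwb⟩ := hd (x s)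
  let u' : ℕ → Fin m → ℝ := fun k => if k < s then u k else w (k - s)
  have hu' : ∀ k < s, u' k = u k := fun k hk => if_pos hk
  have hw' : ∀ k, u' (s + k) = w k := fun k => by
    simp only [u']
    rw [if_neg (by omega), Nat.add_sub_cancel_left]
  obtain ⟨hx, hy⟩ := LTI.eq_state h hu'
  have hxs : ∀ k, G.state (x 0) u' (s + k) = G.state (x s) w k := fun k => by
    rw [G.state_add, hx s le_rfl]
    congr 1
    exact funext hw'
  have hys : ∀ k, G.output (x 0) u' (s + k) = G.output (x s) w k := fun k => by
    rw [output, output, hxs, hw']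
  have hzero : ∀ k, n ≤ k → w k = 0 ∧ G.output (x s) w k = 0 := fun k hk => by
    obtain ⟨j, rfl⟩ := Nat.exists_eq_add_of_le hk
    refine ⟨hw0 _ hk, ?_⟩
    rw [output, G.state_add, hwn, hw0 _ hk]
    rw [show (fun k => w (n + k)) = fun _ => 0 from funext fun k => hw0 _ (by omega),
      G.state_zero]
    simp
  refine ⟨u', G.state (x 0) u', G.output (x 0) u', G.stepAt_state _ _,
    fun k hk => ⟨hu' k hk, hy k hk⟩, rfl, fun k hk => ?_, fun k hk => ?_⟩
  · obtain ⟨j, rfl⟩ := Nat.exists_eq_add_of_le hk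
    rw [hw', hys]
    have hx0 := sqNorm_nonneg (x s)
    rcases Nat.lt_or_ge j n with hj | hj
    · have h1 := Finset.single_le_sum (f := fun i => sqNorm (w i)) (fun i _ => sqNorm_nonneg _)
        (Finset.mem_range.2 hj)
      have h2 := (hr w _ _ fun k _ => G.stepAt_state (x s) w k).2 j hj
      simp only [state] at h1 h2
      constructor
      · have : 0 ≤ C * (1 + K) * sqNorm (x s) := by positivity
        linarith
      · have h3 := mul_le_mul_of_nonneg_left hwb hC.le
        have : 0 ≤ K * sqNorm (x s) := by positivity
        linarith
    · rw [(hzero j hj).1, (hzero j hj).2, sqNorm_zero, sqNorm_zero]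
      exact ⟨by positivity, by positivity⟩
  · obtain ⟨j, rfl⟩ := Nat.exists_eq_add_of_le hk
    rw [add_assoc, hw', hys]
    exact hzero _ (by omega)

namespace Scheme

/-- The data of the scheme come from a trajectory of the system with a persistently exciting
input, whose outputs are measured with noise bounded by the noise level. -/
structure HasData (S : Scheme m p) (G : LTI n m p) (L N : ℕ) (xd : ℕ → Fin n → ℝ)
    (yd εd : ℕ → Fin p → ℝ) : Prop where
  step : ∀ k < N, G.StepAt S.ud xd yd k
  exciting : PersistentlyExciting (L + 2 * n) N S.ud
  noisy : S.yd = yd + εd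
  bound : ∀ k < N, ∀ a, |εd k a| ≤ S.εbar
  pos : 0 < S.εbar

variable {L N : ℕ} {S : Scheme m p} {G : LTI n m p} {xd : ℕ → Fin n → ℝ}
  {yd εd : ℕ → Fin p → ℝ}

lemma l1Norm_coefficients_sq_le (hn : 0 < n) (α : Fin (N + 1 - (n + L)) → ℝ) :
    l1Norm α ^ 2 ≤ N * sqNorm α := by
  have h := l1Norm_sq_le α
  rw [Fintype.card_fin] at h
  have h1 : ((N + 1 - (n + L) : ℕ) : ℝ) ≤ N := by exact_mod_cast by omega
  exact h.trans (mul_le_mul_of_nonneg_right h1 (sqNorm_nonneg _))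

/-- An exact trajectory that comes to rest is a feasible candidate. -/
lemma HasData.exists_feasible (hS : S.HasData G L N xd yd εd) (hn : 0 < n)
    (hG : G.controllabilityMatrix.rank = n) (hα : 0 ≤ S.lα) (hσ : 0 ≤ S.lσ)
    {u : ℕ → Fin m → ℝ} {x : ℕ → Fin n → ℝ} {y : ℕ → Fin p → ℝ} {e : Fin n → Fin p → ℝ}
    (hstep : ∀ k < n + L, G.StepAt u x y k) (he : ∀ i a, |e i a| ≤ S.εbar)
    (hrest : ∀ k, L ≤ k → k < n + L → u k = 0 ∧ y k = 0) (hU : ∀ k < L, u (n + k) ∈ S.U) :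
    ∃ z : Decision n m p L N, S.Feasible (fun i => u i) (fun i => y i + e i) z ∧
      S.cost z ≤ ∑ k ∈ Finset.range L, (wNorm S.R (u (n + k)) + wNorm S.Q (y (n + k))) +
        ((S.lα * S.εbar + S.lσ * (2 * (n + L) * p * N) * S.εbar ^ 2) * cpe L N S.ud xd) *
          (∑ i ∈ Finset.range (n + L), sqNorm (u i) + sqNorm (x 0)) +
        S.lσ * (2 * (n + L) * p) * S.εbar ^ 2 := by
  obtain ⟨α, hαu, hαx, hαb⟩ := exists_coefficients hG hS.step hS.exciting u (x 0)
  have hidx : ∀ i < n + L, ∀ j < N + 1 - (n + L), i + j < N := by omega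
  -- The noise-free data combination shares its input and initial state with the given trajectory,
  -- so it reproduces the outputs.
  have hy : ∀ i < n + L, comb yd α i = y i := by
    have h1 := LTI.eq_state (fun i hi => LTI.StepAt.comb hS.step α (hidx i hi))
      (fun k hk => (hαu k hk).symm)
    have h2 := LTI.eq_state hstep (u' := u) fun _ _ => rfl
    intro i hi
    rw [← h1.2 i hi, hαx, h2.2 i hi]
  let yb : Fin (n + L) → Fin p → ℝ := Fin.append (fun i : Fin n => y i + e i)
    (fun k : Fin L => y (n + k))
  let σ : Fin (n + L) → Fin p → ℝ := fun i => comb S.yd α i - yb i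
  -- The data noise contributes `ε̄ ‖α‖₁`. On the past window the online noise adds another `ε̄`,
  -- because there the predicted output is pinned to the measurement.
  have hσabs : ∀ i a, |σ i a| ≤ S.εbar * (1 + l1Norm α) := by
    intro i a
    have h1 := abs_comb_le hS.bound (hidx i i.2) a (α := α)
    have h2 : comb S.yd α i = y i + comb εd α i := by
      rw [hS.noisy, comb_add, hy i i.2]
    simp only [σ, h2]
    refine Fin.addCases (fun i => ?_) (fun k => ?_) i (motive := fun i =>
      |comb εd α i a| ≤ S.εbar * l1Norm α →
        |(y i + comb εd α i - yb i) a| ≤ S.εbar * (1 + l1Norm α)) h1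
    · intro h1
      have h3 : (y ((Fin.castAdd L i : Fin (n + L)) : ℕ) + comb εd α (Fin.castAdd L i : Fin (n + L))
          - yb (Fin.castAdd L i)) a = comb εd α (Fin.castAdd L i : Fin (n + L)) a - e i a := by
        simp [yb]
      rw [h3]
      have := abs_sub (comb εd α (Fin.castAdd L i : Fin (n + L)) a) (e i a)
      linarith [he i a]
    · intro h1
      have h3 : (y ((Fin.natAdd n k : Fin (n + L)) : ℕ) + comb εd α (Fin.natAdd n k : Fin (n + L))
          - yb (Fin.natAdd n k)) a = comb εd α (Fin.natAdd n k : Fin (n + L)) a := by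
        simp [yb]
      rw [h3]
      linarith [hS.pos]
  refine ⟨⟨α, σ, fun i => u i, yb⟩, ⟨fun i a => ?_, fun i a => ?_, fun i => rfl, fun i => ?_,
    fun k hk => ?_, fun k => hU k k.2, fun k a => hσabs _ a⟩, ?_⟩
  · rw [hankel_mulVec, hαu i i.2]
  · rw [hankel_mulVec]
    simp [σ]
  · simp [yb]
  · have := hrest (n + k) (by omega) (by omega)
    simpa [yb] using this
  · have hl1 := l1Norm_coefficients_sq_le hn α
    have hA := sqNorm_nonneg α
    have hl0 := l1Norm_nonneg α
    have hsq : ∀ i, sqNorm (σ i) ≤ p * (S.εbar ^ 2 * (2 + 2 * (N * sqNorm α))) := by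
      intro i
      have h1 := sqNorm_le_of_abs_le (hσabs i)
      rw [Fintype.card_fin, mul_pow] at h1
      have h2 : (1 + l1Norm α) ^ 2 ≤ 2 + 2 * (N * sqNorm α) := by
        nlinarith [sq_nonneg (1 - l1Norm α)]
      exact h1.trans (mul_le_mul_of_nonneg_left
        (mul_le_mul_of_nonneg_left h2 (sq_nonneg _)) (Nat.cast_nonneg _))
    have hsum : ∑ i, sqNorm (σ i) ≤
        (n + L) * (p * (S.εbar ^ 2 * (2 + 2 * (N * sqNorm α)))) := by
      have := Finset.sum_le_card_nsmul Finset.univ _ _ (fun i _ => hsq i)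
      simpa using this
    have hst : ∑ k : Fin L, (wNorm S.R (u (Fin.natAdd n k : Fin (n + L))) +
        wNorm S.Q (yb (Fin.natAdd n k))) =
        ∑ k ∈ Finset.range L, (wNorm S.R (u (n + k)) + wNorm S.Q (y (n + k))) := by
      rw [Finset.sum_range]
      simp [yb]
    simp only [cost, hst]
    have h1 := mul_le_mul_of_nonneg_left hsum hσ
    have h2 : 0 ≤ S.lα * S.εbar + S.lσ * (2 * (n + L) * p * N) * S.εbar ^ 2 := by
      have := hS.pos
      positivity
    have h3 := mul_le_mul_of_nonneg_left hαb h2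
    linarith

/-- The part of the suboptimality that stems from the noise: the slack, the noise level, and the
noise amplified by the coefficients. -/
noncomputable def mismatch (S : Scheme m p) (z : Decision n m p L N) : ℝ :=
  ∑ i, sqNorm (z.σ i) + S.εbar ^ 2 * (1 + N * sqNorm z.α)

lemma mismatch_nonneg (S : Scheme m p) (z : Decision n m p L N) : 0 ≤ S.mismatch z := by
  have h1 : 0 ≤ ∑ i, sqNorm (z.σ i) := Finset.sum_nonneg fun _ _ => sqNorm_nonneg _
  have h2 := sqNorm_nonneg z.α
  unfold mismatch
  positivity

/-- The predicted outputs are close to the outputs of the system under the predicted inputs. -/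
lemma exists_prediction_error_bound (hn : 0 < n) (G : LTI n m p)
    (hG : G.observabilityMatrix.rank = n) (L N : ℕ) :
    ∃ C : ℝ, 0 < C ∧ ∀ (S : Scheme m p) (xd : ℕ → Fin n → ℝ) (yd εd : ℕ → Fin p → ℝ),
      S.HasData G L N xd yd εd → ∀ (upast : Fin n → Fin m → ℝ) (e : Fin n → Fin p → ℝ)
      (u : ℕ → Fin m → ℝ) (x : ℕ → Fin n → ℝ) (y : ℕ → Fin p → ℝ) (z : Decision n m p L N),
      (∀ i a, |e i a| ≤ S.εbar) → S.Feasible upast (fun i => y i + e i) z →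
      (∀ k < n + L, G.StepAt u x y k) → (∀ i : Fin (n + L), z.ubar i = u i) →
      ∀ i : Fin (n + L), sqNorm (y i - z.ybar i) ≤ C * S.mismatch z := by
  obtain ⟨c, hc, hr⟩ := G.exists_response_bound (n + L)
  obtain ⟨o, ho, hobs⟩ := G.exists_observability_bound hG
  refine ⟨2 * (c * (o * (n * (4 + 6 * p)))) + 2 * (2 + 2 * p), by positivity, ?_⟩
  intro S xd yd εd hS upast e u x y z he hz hstep hu
  set E := S.mismatch z with hE
  have hidx : ∀ i < n + L, ∀ j < N + 1 - (n + L), i + j < N := by omega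
  have hE0 : 0 ≤ E := S.mismatch_nonneg z
  have hA := sqNorm_nonneg z.α
  have hεE : S.εbar ^ 2 ≤ E := by
    have h1 : 0 ≤ ∑ i, sqNorm (z.σ i) := Finset.sum_nonneg fun _ _ => sqNorm_nonneg _
    have h2 : 0 ≤ S.εbar ^ 2 * (N * sqNorm z.α) := by positivity
    rw [hE, mismatch]
    linarith
  have hb : ∀ i : Fin (n + L), sqNorm (comb yd z.α i - z.ybar i) ≤ (2 + 2 * p) * E := by
    intro i
    have h1 : comb yd z.α i - z.ybar i = z.σ i - comb εd z.α i := by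
      funext a
      have := hz.output_model i a
      rw [hankel_mulVec, hS.noisy, comb_add] at this
      simp only [Pi.sub_apply, Pi.add_apply] at this ⊢
      linarith
    rw [h1]
    have h2 := sqNorm_le_of_abs_le (abs_comb_le hS.bound (hidx i i.2) (α := z.α))
    rw [Fintype.card_fin, mul_pow] at h2
    have h3 := sqNorm_sub_le (z.σ i) (comb εd z.α i)
    have h4 := Finset.single_le_sum (f := fun i => sqNorm (z.σ i)) (fun i _ => sqNorm_nonneg _)
      (Finset.mem_univ i)
    have h5 : sqNorm (z.σ i) ≤ E := by
      have h6 : 0 ≤ S.εbar ^ 2 * (1 + N * sqNorm z.α) := by positivity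
      rw [hE, mismatch]
      linarith
    have h7 : S.εbar ^ 2 * l1Norm z.α ^ 2 ≤ E := by
      have h8 := mul_le_mul_of_nonneg_left (l1Norm_coefficients_sq_le hn z.α) (sq_nonneg S.εbar)
      have h9 : 0 ≤ ∑ i, sqNorm (z.σ i) := Finset.sum_nonneg fun _ _ => sqNorm_nonneg _
      have := sq_nonneg S.εbar
      rw [hE, mismatch]
      linarith
    have := mul_le_mul_of_nonneg_left h7 (Nat.cast_nonneg (α := ℝ) p)
    linarith
  -- Compared with the noise-free data combination, the input difference is zero. The output
  -- difference is therefore governed by its initial state, which the first `n` outputs determine.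
  have hstep' : ∀ k < n + L, G.StepAt (fun k => u k - comb S.ud z.α k)
      (fun k => x k - comb xd z.α k) (fun k => y k - comb yd z.α k) k := fun k hk =>
    (hstep k hk).sub (LTI.StepAt.comb hS.step z.α (hidx k hk))
  have hu0 : ∀ k < n + L, u k - comb S.ud z.α k = 0 := by
    intro k hk
    rw [← hu ⟨k, hk⟩, sub_eq_zero]
    funext a
    rw [hz.input_model, hankel_mulVec]
  have hpast : ∀ i < n, sqNorm (y i - comb yd z.α i) ≤ (4 + 6 * p) * E := by
    intro i hi
    have h1 : y i - comb yd z.α i =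
        -e ⟨i, hi⟩ - (comb yd z.α i - z.ybar (Fin.castAdd L ⟨i, hi⟩)) := by
      rw [hz.output_init]
      simp only
      abel
    have h2 := hb (Fin.castAdd L ⟨i, hi⟩)
    have h3 : sqNorm (-e ⟨i, hi⟩) ≤ p * S.εbar ^ 2 := by
      have := sqNorm_le_of_abs_le (v := -e ⟨i, hi⟩) (c := S.εbar)
        (fun a => by rw [Pi.neg_apply, abs_neg]; exact he _ a)
      rwa [Fintype.card_fin] at this
    have h4 := sqNorm_sub_le (-e ⟨i, hi⟩) (comb yd z.α i - z.ybar (Fin.castAdd L ⟨i, hi⟩))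
    rw [← h1] at h4
    simp only [Fin.val_castAdd] at h2
    have := mul_le_mul_of_nonneg_left hεE (Nat.cast_nonneg (α := ℝ) p)
    linarith
  have hx0 : sqNorm (x 0 - comb xd z.α 0) ≤ o * (n * ((4 + 6 * p) * E)) := by
    refine (hobs _ _ _ fun k hk => hstep' k (by omega)).trans (mul_le_mul_of_nonneg_left ?_ ho.le)
    have := Finset.sum_le_card_nsmul (Finset.range n) (fun i => sqNorm (u i - comb S.ud z.α i) +
      sqNorm (y i - comb yd z.α i)) ((4 + 6 * p) * E) (fun i hi => by
        have hi := Finset.mem_range.1 hi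
        rw [hu0 i (by omega), sqNorm_zero, zero_add]
        exact hpast i hi)
    simpa using this
  intro i
  have h1 := (hr _ _ _ hstep').2 i i.2
  rw [Finset.sum_eq_zero (fun k hk => by
    rw [hu0 k (Finset.mem_range.1 hk), sqNorm_zero]), add_zero] at h1
  have h2 := sqNorm_add_le (y i - comb yd z.α i) (comb yd z.α i - z.ybar i)
  rw [sub_add_sub_cancel] at h2
  have h3 := mul_le_mul_of_nonneg_left hx0 hc.le
  have h4 := hb i
  linarith

end Scheme

end DDMPC

/-! ### Quadratic upper bound near the origin; IOSS Lyapunov functions -/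

namespace DDMPC

variable {n m p : ℕ}

lemma sqNorm_stack_window (n : ℕ) (u : ℕ → Fin m → ℝ) (y : ℕ → Fin p → ℝ) (s : ℕ) :
    sqNorm (stack (window n u s) (window n y s)) =
      ∑ i ∈ Finset.range n, (sqNorm (u (s + i)) + sqNorm (y (s + i))) := by
  rw [stack, sqNorm_sumElim, sqNorm_prod (window n u s), sqNorm_prod (window n y s),
    Finset.sum_add_distrib, Finset.sum_range, Finset.sum_range]
  rfl

lemma window_shift {q : ℕ} (n : ℕ) (v : ℕ → Fin q → ℝ) (t s : ℕ) :
    window n (fun k => v (t + k)) s = window n v (t + s) := by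
  funext i
  simp [window, add_assoc]

lemma exists_pos_forall_sqNorm_le_mem {U : Set (Fin m → ℝ)} (hU : (0 : Fin m → ℝ) ∈ interior U) :
    ∃ ρ : ℝ, 0 < ρ ∧ ∀ v, sqNorm v ≤ ρ → v ∈ U := by
  obtain ⟨r, hr, h⟩ := Metric.mem_nhds_iff.1 (mem_interior_iff_mem_nhds.1 hU)
  refine ⟨(r / 2) ^ 2, by positivity, fun v hv => h ?_⟩
  rw [mem_ball_zero_iff]
  refine lt_of_le_of_lt ((pi_norm_le_iff_of_nonneg (by positivity)).2 fun i => ?_) (half_lt_self hr)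
  exact abs_le_of_sq_le_sq ((sq_le_sqNorm v i).trans hv) (by positivity)

/-- Initial and final states of a window are bounded by the extended state. -/
lemma LTI.exists_window_bound (G : LTI n m p) (hG : G.observabilityMatrix.rank = n) :
    ∃ C : ℝ, 0 < C ∧ ∀ (u : ℕ → Fin m → ℝ) (x : ℕ → Fin n → ℝ) (y : ℕ → Fin p → ℝ),
      (∀ k < n, G.StepAt u x y k) →
      sqNorm (x 0) ≤ C * sqNorm (stack (window n u 0) (window n y 0)) ∧
      sqNorm (x n) ≤ C * sqNorm (stack (window n u 0) (window n y 0)) := by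
  obtain ⟨o, ho, hobs⟩ := G.exists_observability_bound hG
  obtain ⟨c, hc, hr⟩ := G.exists_response_bound n
  refine ⟨o + c * (o + 1), by positivity, fun u x y h => ?_⟩
  have h1 := hobs u x y h
  have h2 := (hr u x y h).1 n le_rfl
  have h0 := sqNorm_nonneg (stack (window n u 0) (window n y 0))
  have hx := sqNorm_stack_window n u y 0
  simp only [zero_add] at hx
  rw [← hx] at h1
  have h3 : ∑ i ∈ Finset.range n, sqNorm (u i) ≤
      sqNorm (stack (window n u 0) (window n y 0)) := by
    rw [hx]
    exact Finset.sum_le_sum fun i _ => le_add_of_nonneg_right (sqNorm_nonneg _)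
  have h4 := mul_le_mul_of_nonneg_left (add_le_add h1 h3) hc.le
  constructor
  · have : 0 ≤ c * (o + 1) * sqNorm (stack (window n u 0) (window n y 0)) := by positivity
    linarith
  · have : 0 ≤ o * sqNorm (stack (window n u 0) (window n y 0)) := by positivity
    linarith

namespace Scheme

variable {L N : ℕ}

/-- The gain from the energy of a candidate trajectory to its regularization cost. -/
noncomputable def regGain (S : Scheme m p) (L N : ℕ) (xd : ℕ → Fin n → ℝ) : ℝ :=
  (S.lα * S.εbar + S.lσ * (2 * (n + L) * p * N) * S.εbar ^ 2) * cpe L N S.ud xd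

lemma regGain_nonneg {S : Scheme m p} (hα : 0 ≤ S.lα) (hσ : 0 ≤ S.lσ) (hε : 0 ≤ S.εbar) (L N : ℕ)
    (xd : ℕ → Fin n → ℝ) : 0 ≤ S.regGain L N xd :=
  mul_nonneg (by positivity) (cpe_nonneg L N S.ud xd)

/-- Near the origin, the problem is feasible and its optimal cost is bounded quadratically. -/
lemma exists_local_bound (hn : 0 < n) (hL : 2 * n ≤ L) (N : ℕ) (G : LTI n m p) (hG : G.IsMinimal)
    (Q : Matrix (Fin p) (Fin p) ℝ) (R : Matrix (Fin m) (Fin m) ℝ)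
    (U : Set (Fin m → ℝ)) (hU : (0 : Fin m → ℝ) ∈ interior U) :
    ∃ r C : ℝ, 0 < r ∧ 0 < C ∧ ∀ (S : Scheme m p) (xd : ℕ → Fin n → ℝ) (yd εd : ℕ → Fin p → ℝ),
      S.HasData G L N xd yd εd → S.Q = Q → S.R = R → S.U = U → 0 ≤ S.lα → 0 ≤ S.lσ →
      S.regGain L N xd ≤ 1 → ∀ (u : ℕ → Fin m → ℝ) (x : ℕ → Fin n → ℝ) (y : ℕ → Fin p → ℝ)
      (e : Fin n → Fin p → ℝ), (∀ k < n, G.StepAt u x y k) → (∀ i a, |e i a| ≤ S.εbar) →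
      sqNorm (stack (window n u 0) (window n y 0)) ≤ r →
      ∃ z : Decision n m p L N, S.Feasible (fun i => u i) (fun i => y i + e i) z ∧
        S.cost z ≤ C * sqNorm (stack (window n u 0) (window n y 0)) +
          S.lσ * (2 * (n + L) * p) * S.εbar ^ 2 := by
  obtain ⟨K, hK, hw⟩ := G.exists_window_bound hG.2
  obtain ⟨d, hd, hdb⟩ := G.exists_deadbeat_extension hG.1
  obtain ⟨q, hq, hQ⟩ := exists_wNorm_le Q
  obtain ⟨r, hr, hR⟩ := exists_wNorm_le R
  obtain ⟨ρ, hρ, hU'⟩ := exists_pos_forall_sqNorm_le_mem hU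
  -- On this radius every deadbeat input has squared norm at most `ρ` and so lies in `U`. The second
  -- constant adds the stage costs and, as `regGain ≤ 1`, the energy of the candidate.
  refine ⟨ρ / (d * K), L * ((r + q) * (d * K)) + ((n + L) * (1 + d * K) + K), by positivity,
    by positivity, ?_⟩
  intro S xd yd εd hS hSQ hSR hSU hα hσ hκ u x y e hstep he hξ
  obtain ⟨u', x', y', hstep', hpre, hx0, hpost, hrest⟩ := hdb u x y n hstep
  obtain ⟨hw0, hwn⟩ := hw u x y hstep
  set X := sqNorm (stack (window n u 0) (window n y 0)) with hX
  have hX0 : 0 ≤ X := sqNorm_nonneg _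
  have hdX : d * sqNorm (x n) ≤ d * K * X := by
    have := mul_le_mul_of_nonneg_left hwn hd.le
    linarith
  have hdXρ : d * K * X ≤ ρ := by
    rwa [le_div_iff₀ (by positivity), mul_comm] at hξ
  obtain ⟨z, hz, hcost⟩ := hS.exists_feasible hn hG.1 hα hσ (u := u') (x := x') (y := y') (e := e)
    (fun k _ => hstep' k) he (fun k hk _ => hrest k (by omega)) (fun k _ => by
      rw [hSU]
      exact hU' _ (((hpost (n + k) (by omega)).1.trans hdX).trans hdXρ))
  refine ⟨z, ?_, ?_⟩
  · have h1 : (fun i : Fin n => u' i) = fun i : Fin n => u i := funext fun i => (hpre i i.2).1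
    have h2 : (fun i : Fin n => y' i + e i) = fun i : Fin n => y i + e i :=
      funext fun i => by rw [(hpre i i.2).2]
    rwa [h1, h2] at hz
  · have h1 : ∑ k ∈ Finset.range L, (wNorm S.R (u' (n + k)) + wNorm S.Q (y' (n + k))) ≤
        L * ((r + q) * (d * K * X)) := by
      have := Finset.sum_le_card_nsmul (Finset.range L)
        (fun k => wNorm S.R (u' (n + k)) + wNorm S.Q (y' (n + k))) ((r + q) * (d * K * X))
        (fun k _ => by
          obtain ⟨e1, e2⟩ := hpost (n + k) (by omega)
          have e3 := mul_le_mul_of_nonneg_left (e1.trans hdX) hr.le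
          have e4 := mul_le_mul_of_nonneg_left (e2.trans hdX) hq.le
          rw [hSR, hSQ]
          linarith [hR (u' (n + k)), hQ (y' (n + k))])
      simpa using this
    have h2 : ∑ i ∈ Finset.range (n + L), sqNorm (u' i) ≤ (n + L) * ((1 + d * K) * X) := by
      have := Finset.sum_le_card_nsmul (Finset.range (n + L)) (fun i => sqNorm (u' i))
        ((1 + d * K) * X) (fun i _ => by
          have hdK : 0 ≤ d * K * X := by positivity
          rcases Nat.lt_or_ge i n with hi | hi
          · have hui : sqNorm (u i) ≤ X := by
              have e1 := sqNorm_stack_window n u y 0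
              simp only [zero_add] at e1
              rw [hX, e1]
              exact (le_add_of_nonneg_right (sqNorm_nonneg _)).trans
                (Finset.single_le_sum (f := fun i => sqNorm (u i) + sqNorm (y i))
                  (fun i _ => add_nonneg (sqNorm_nonneg _) (sqNorm_nonneg _))
                  (Finset.mem_range.2 hi))
            simp only [(hpre i hi).1]
            linarith
          · have := (hpost i hi).1
            linarith)
      simpa using this
    have h3 : S.regGain L N xd * (∑ i ∈ Finset.range (n + L), sqNorm (u' i) + sqNorm (x' 0)) ≤
        (n + L) * ((1 + d * K) * X) + K * X := by
      rw [hx0]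
      have h0 : 0 ≤ ∑ i ∈ Finset.range (n + L), sqNorm (u' i) + sqNorm (x 0) :=
        add_nonneg (Finset.sum_nonneg fun _ _ => sqNorm_nonneg _) (sqNorm_nonneg _)
      have := mul_le_mul_of_nonneg_right hκ h0
      linarith
    unfold regGain at h3
    linarith

end Scheme

namespace IsIOSS

variable {G : LTI n m p}
  {P : Matrix ((Fin n × Fin m) ⊕ (Fin n × Fin p)) ((Fin n × Fin m) ⊕ (Fin n × Fin p)) ℝ}
  {c₁ c₂ : ℝ}

lemma step (h : IsIOSS G P c₁ c₂) {u : ℕ → Fin m → ℝ} {x : ℕ → Fin n → ℝ} {y : ℕ → Fin p → ℝ}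
    (hstep : ∀ k, G.StepAt u x y k) (t : ℕ) :
    wNorm P (stack (window n u (t + 1)) (window n y (t + 1))) ≤
      wNorm P (stack (window n u t) (window n y t)) -
        1 / 2 * sqNorm (stack (window n u t) (window n y t)) +
        (c₁ * sqNorm (u (n + t)) + c₂ * sqNorm (y (n + t))) := by
  have h1 := h.2.2.2 (fun k => u (t + k)) (fun k => x (t + k)) (fun k => y (t + k))
    (fun k _ => hstep (t + k))
  simp only [window_shift, add_zero, add_comm t n] at h1
  linarith

/-- Of the dissipation terms only the first is kept; it alone is needed for the decrease over a
block of `n` steps. -/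
lemma multistep (h : IsIOSS G P c₁ c₂) {u : ℕ → Fin m → ℝ} {x : ℕ → Fin n → ℝ}
    {y : ℕ → Fin p → ℝ} (hstep : ∀ k, G.StepAt u x y k) {t : ℕ} (ht : 0 < t) :
    wNorm P (stack (window n u t) (window n y t)) ≤
      wNorm P (stack (window n u 0) (window n y 0)) -
        1 / 2 * sqNorm (stack (window n u 0) (window n y 0)) +
        ∑ i ∈ Finset.range t, (c₁ * sqNorm (u (n + i)) + c₂ * sqNorm (y (n + i))) := by
  induction t, ht using Nat.le_induction with
  | base => simpa using h.step hstep 0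
  | succ t _ ih =>
    rw [Finset.sum_range_succ]
    have := h.step hstep t
    have := sqNorm_nonneg (stack (window n u t) (window n y t))
    linarith

end IsIOSS

/-- The shift register furnishes an IOSS Lyapunov function. -/
lemma exists_isIOSS (hn : 0 < n) (G : LTI n m p) :
    ∃ (P : Matrix ((Fin n × Fin m) ⊕ (Fin n × Fin p)) ((Fin n × Fin m) ⊕ (Fin n × Fin p)) ℝ)
      (c₁ c₂ : ℝ), IsIOSS G P c₁ c₂ := by
  classical
  -- The weights run from `1` for the oldest sample to `n` for the newest. A shift lowers the weight
  -- of each old sample by one, a total loss of `‖ξ‖²`, and the new sample enters with weight `n`,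
  -- the gain.
  let d : (Fin n × Fin m) ⊕ (Fin n × Fin p) → ℝ :=
    Sum.elim (fun a => (a.1 : ℕ) + 1) (fun b => (b.1 : ℕ) + 1)
  have hW : ∀ (u : ℕ → Fin m → ℝ) (y : ℕ → Fin p → ℝ) (s : ℕ),
      wNorm (Matrix.diagonal d) (stack (window n u s) (window n y s)) =
        ∑ i ∈ Finset.range n, ((i : ℝ) + 1) * (sqNorm (u (s + i)) + sqNorm (y (s + i))) := by
    intro u y s
    simp only [wNorm, dotProduct, Matrix.mulVec_diagonal, Fintype.sum_sum_type,
      Fintype.sum_prod_type, Finset.sum_range, mul_add, Finset.sum_add_distrib, stack, d,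
      Sum.elim_inl, Sum.elim_inr, window, sqNorm, Finset.mul_sum]
    congr 1 <;> exact Finset.sum_congr rfl fun _ _ => Finset.sum_congr rfl fun _ _ => by ring
  have hn' : (0 : ℝ) < n := by exact_mod_cast hn
  refine ⟨Matrix.diagonal d, n, n, Matrix.PosDef.diagonal fun i => ?_, hn', hn', ?_⟩
  · rcases i with i | i <;> simp only [d, Sum.elim_inl, Sum.elim_inr] <;> positivity
  · intro u x y _
    rw [hW, hW, sqNorm_stack_window]
    have h1 : ∀ v : ℕ → ℝ, ∑ i ∈ Finset.range n, ((i : ℝ) + 1) * v (1 + i) =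
        ∑ i ∈ Finset.range n, (i : ℝ) * v i + n * v n := by
      intro v
      rw [← Finset.sum_range_succ (fun i => (i : ℝ) * v i), Finset.sum_range_succ']
      simp [add_comm]
    have h2 := h1 fun k => sqNorm (u k) + sqNorm (y k)
    rw [h2]
    simp only [zero_add]
    have h3 : 0 ≤ ∑ i ∈ Finset.range n, (sqNorm (u i) + sqNorm (y i)) :=
      Finset.sum_nonneg fun _ _ => add_nonneg (sqNorm_nonneg _) (sqNorm_nonneg _)
    simp only [add_mul, one_mul, Finset.sum_add_distrib (f := fun i : ℕ =>
      (i : ℝ) * (sqNorm (u i) + sqNorm (y i)))]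
    linarith

end DDMPC

/-! ### Decrease of the Lyapunov function over one block of `n` steps -/

namespace DDMPC

variable {n m p L N : ℕ}

namespace Scheme

lemma sum_shift_eq_sub {g : ℕ → ℝ} (hg : ∀ i, L ≤ i → g i = 0) (n : ℕ) :
    ∑ k ∈ Finset.range L, g (n + k) = ∑ k ∈ Finset.range L, g k - ∑ k ∈ Finset.range n, g k := by
  have h1 := Finset.sum_range_add g n L
  have h2 := Finset.sum_range_add g L n
  rw [add_comm n L, h2, Finset.sum_eq_zero (s := Finset.range n) fun i _ => hg _ (by omega)] at h1
  linarith

/-- The decrease of the Lyapunov function candidate over one step of the scheme: shifting a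
feasible solution and appending a deadbeat input yields a candidate for the next instant. -/
lemma exists_step_bound (hn : 0 < n) (hL : 2 * n ≤ L) (N : ℕ) (G : LTI n m p) (hG : G.IsMinimal)
    {Q : Matrix (Fin p) (Fin p) ℝ} (hQ : Q.PosDef) {R : Matrix (Fin m) (Fin m) ℝ} (hR : R.PosDef)
    {U : Set (Fin m → ℝ)} (hU : (0 : Fin m → ℝ) ∈ interior U)
    {P : Matrix ((Fin n × Fin m) ⊕ (Fin n × Fin p)) ((Fin n × Fin m) ⊕ (Fin n × Fin p)) ℝ}
    {c₁ c₂ : ℝ} (hP : IsIOSS G P c₁ c₂) {γ : ℝ} (hγ : 0 < γ)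
    (hγR : ∀ v : Fin m → ℝ, γ * c₁ * sqNorm v ≤ wNorm R v)
    (hγQ : ∀ v : Fin p → ℝ, γ * (2 * c₂) * sqNorm v ≤ wNorm Q v) {η : ℝ} (hη : 0 < η) :
    ∃ C : ℝ, 0 < C ∧ ∀ (S : Scheme m p) (xd : ℕ → Fin n → ℝ) (yd εd : ℕ → Fin p → ℝ),
      S.HasData G L N xd yd εd → S.Q = Q → S.R = R → S.U = U → 0 ≤ S.lα → 0 ≤ S.lσ →
      ∀ (u : ℕ → Fin m → ℝ) (x : ℕ → Fin n → ℝ) (y ε : ℕ → Fin p → ℝ) (z : Decision n m p L N),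
      (∀ k, G.StepAt u x y k) → (∀ k a, |ε k a| ≤ S.εbar) →
      S.Feasible (window n u 0) (window n (y + ε) 0) z →
      (∀ k : Fin L, (k : ℕ) < n → u (n + (k : ℕ)) = z.ubar (Fin.natAdd n k)) →
      C * S.mismatch z ≤ 1 →
      ∃ z' : Decision n m p L N, S.Feasible (window n u n) (window n (y + ε) n) z' ∧
        S.cost z' + γ * wNorm P (stack (window n u n) (window n y n)) ≤
          S.cost z + γ * wNorm P (stack (window n u 0) (window n y 0)) -
          γ / 2 * sqNorm (stack (window n u 0) (window n y 0)) -
          (S.lα * S.εbar * sqNorm z.α + S.lσ * ∑ i, sqNorm (z.σ i)) +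
          η * S.cost z + C * S.mismatch z +
          S.regGain L N xd * (C * (S.cost z + S.mismatch z +
            sqNorm (stack (window n u 0) (window n y 0)))) +
          S.lσ * (2 * (n + L) * p) * S.εbar ^ 2 := by
  obtain ⟨w, hw, hwin⟩ := G.exists_window_bound hG.2
  obtain ⟨d, hd, hdb⟩ := G.exists_deadbeat_extension hG.1
  obtain ⟨q, hq, hQ'⟩ := exists_wNorm_le Q
  obtain ⟨r, hr, hR'⟩ := exists_wNorm_le R
  obtain ⟨ρ, hρ, hU'⟩ := exists_pos_forall_sqNorm_le_mem hU
  obtain ⟨b, hb, herr⟩ := exists_prediction_error_bound hn G hG.2 L N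
  obtain ⟨o, ho, hobs⟩ := G.exists_observability_bound hG.2
  have hc₁ := hP.2.1
  have hc₂ := hP.2.2.1
  set f := d * (o * (n * b)) with hf
  have hf0 : 0 < f := by positivity
  set D := (1 + η⁻¹) * (q * b) + (r + q) * f with hD
  have hD0 : 0 < D := by positivity
  -- `f` bounds the deadbeat tail and `D` the error per stage, relative to the mismatch. The
  -- constant sums what keeps the tail in `U`, the errors in stage costs and IOSS supply, and the
  -- energy of the candidate, so that it dominates each of them.
  refine ⟨f / ρ + (L * D + n * (γ * (2 * c₂) * b)) + ((γ * c₁)⁻¹ + (n + L) * f + w),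
    by positivity, ?_⟩
  intro S xd yd εd hS hSQ hSR hSU hα hσ u x y ε z hstep hε hz happ hmis
  set E := S.mismatch z with hE
  have hE0 : 0 ≤ E := S.mismatch_nonneg z
  set X := sqNorm (stack (window n u 0) (window n y 0)) with hX
  have hX0 : 0 ≤ X := sqNorm_nonneg _
  have hfE0 : 0 ≤ f * E := by positivity
  have hfE : f * E ≤ ρ := by
    have h1 : f / ρ * E ≤ 1 := by
      refine le_trans (mul_le_mul_of_nonneg_right ?_ hE0) hmis
      have : 0 ≤ (L * D + n * (γ * (2 * c₂) * b)) + ((γ * c₁)⁻¹ + (n + L) * f + w) := by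
        positivity
      linarith
    rwa [div_mul_eq_mul_div, div_le_one hρ] at h1
  -- the predicted trajectory, extended by zero
  let ub : ℕ → Fin m → ℝ := fun i => if h : i < n + L then z.ubar ⟨i, h⟩ else 0
  let yb : ℕ → Fin p → ℝ := fun i => if h : i < n + L then z.ybar ⟨i, h⟩ else 0
  have hub : ∀ i : Fin (n + L), z.ubar i = ub i := fun i => by simp [ub]
  have hyb : ∀ i : Fin (n + L), z.ybar i = yb i := fun i => by simp [yb]
  have huu : ∀ i < 2 * n, ub i = u i := by
    intro i hi
    rcases Nat.lt_or_ge i n with hin | hin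
    · have h1 := hz.input_init ⟨i, hin⟩
      rw [hub] at h1
      simpa [window] using h1
    · obtain ⟨k, rfl⟩ := Nat.exists_eq_add_of_le hin
      have h1 := happ ⟨k, by omega⟩ (by simp only; omega)
      rw [hub] at h1
      simpa using h1.symm
  obtain ⟨hxh, hyh⟩ := LTI.eq_state (T := 2 * n) (fun k _ => hstep k) huu
  -- The true response to the predicted inputs; it coincides with the closed loop up to position `2
  -- n`, where the next past window ends.
  set xh := G.state (x 0) ub
  set yh := G.output (x 0) ub
  have hsteph : ∀ k, G.StepAt ub xh yh k := G.stepAt_state _ _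
  have hyerr : ∀ i, i < n + L → sqNorm (yh i - yb i) ≤ b * E := by
    intro i hi
    have h1 := herr S xd yd εd hS _ (fun i => ε i) ub xh yh z (fun i a => hε _ _) (by
      convert hz using 1
      funext i
      simp [window, hyh i (by omega)]) (fun k _ => hsteph k) hub ⟨i, hi⟩
    rw [hyb] at h1
    exact h1
  -- at the end of the horizon the state is small
  have hend : sqNorm (xh L) ≤ o * (n * (b * E)) := by
    refine (hobs _ _ _ fun k _ => (hsteph (L + k)).shift).trans
      (mul_le_mul_of_nonneg_left ?_ ho.le)
    have := Finset.sum_le_card_nsmul (Finset.range n)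
      (fun i => sqNorm (ub (L + i)) + sqNorm (yh (L + i))) (b * E) (fun i hi => by
        have hi := Finset.mem_range.1 hi
        have h1 := hz.terminal ⟨L + i - n, by omega⟩ (by simp only; omega)
        rw [hub, hyb] at h1
        simp only [Fin.val_natAdd, show n + (L + i - n) = L + i by omega] at h1
        have h2 := hyerr (L + i) (by omega)
        rw [h1.2, sub_zero] at h2
        rw [h1.1, sqNorm_zero, zero_add]
        exact h2)
    simpa using this
  -- In shifted time the deadbeat input occupies `L - n, …, L - 1`, which leaves the last `n`
  -- positions at rest as the terminal constraint demands. Because `L ≥ 2 n`, the new past window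
  -- lies before it.
  obtain ⟨u', x', y', hstep', hpre, hx0, hpost, hrest⟩ :=
    hdb (fun k => ub (n + k)) (fun k => xh (n + k)) (fun k => yh (n + k)) (L - n)
      (fun k _ => (hsteph (n + k)).shift)
  simp only [add_zero, show n + (L - n) = L by omega] at hx0 hpost
  have hdE : d * sqNorm (xh L) ≤ f * E := by
    have := mul_le_mul_of_nonneg_left hend hd.le
    rw [hf]
    linarith
  have hx'0 : x' 0 = x n := by rw [hx0, hxh n (by omega)]
  obtain ⟨z', hz', hcost⟩ := hS.exists_feasible hn hG.1 hα hσ (u := u') (x := x') (y := y')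
    (e := fun i => ε (n + i)) (fun k _ => hstep' k) (fun i a => hε _ _)
    (fun k hk _ => hrest k (by omega)) (fun k hk => by
      rw [hSU]
      rcases Nat.lt_or_ge (n + k) (L - n) with h | h
      · have h1 := hz.input_constraint ⟨n + k, by omega⟩
        rw [hub, hSU] at h1
        rw [(hpre _ h).1]
        exact h1
      · exact hU' _ (((hpost _ h).1.trans hdE).trans hfE))
  refine ⟨z', ?_, ?_⟩
  · convert hz' using 1
    · funext i
      rw [(hpre i (by omega)).1, huu _ (by omega)]
      rfl
    · funext i
      rw [(hpre i (by omega)).2, hyh _ (by omega)]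
      rfl
  -- stage costs along the prediction
  let g : ℕ → ℝ := fun i => wNorm R (ub (n + i)) + wNorm Q (yb (n + i))
  have hg0 : ∀ i, 0 ≤ g i := fun i => add_nonneg (wNorm_nonneg hR _) (wNorm_nonneg hQ _)
  have hgL : ∀ i, L ≤ i → g i = 0 := fun i hi => by
    have h1 : ub (n + i) = 0 := dif_neg (by omega)
    have h2 : yb (n + i) = 0 := dif_neg (by omega)
    simp only [g, h1, h2, wNorm_zero, add_zero]
  have hstage : S.cost z = ∑ i ∈ Finset.range L, g i +
      (S.lα * S.εbar * sqNorm z.α + S.lσ * ∑ i, sqNorm (z.σ i)) := by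
    rw [cost, hSR, hSQ, Finset.sum_range, add_assoc]
    congr 1
    exact Finset.sum_congr rfl fun k _ => by rw [hub, hyb]; rfl
  have hreg0 : 0 ≤ S.lα * S.εbar * sqNorm z.α + S.lσ * ∑ i, sqNorm (z.σ i) := by
    have h1 : 0 ≤ ∑ i, sqNorm (z.σ i) := Finset.sum_nonneg fun _ _ => sqNorm_nonneg _
    have h2 := sqNorm_nonneg z.α
    have := hS.pos
    positivity
  have hcand : ∑ k ∈ Finset.range L, (wNorm S.R (u' (n + k)) + wNorm S.Q (y' (n + k))) ≤
      (1 + η) * (∑ k ∈ Finset.range L, g k - ∑ k ∈ Finset.range n, g k) + L * (D * E) := by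
    have h1 : ∀ k ∈ Finset.range L, wNorm S.R (u' (n + k)) + wNorm S.Q (y' (n + k)) ≤
        (1 + η) * g (n + k) + D * E := by
      intro k hk
      have hk := Finset.mem_range.1 hk
      rw [hSR, hSQ]
      rcases Nat.lt_or_ge (n + k) (L - n) with h | h
      · rw [(hpre _ h).1, (hpre _ h).2]
        have h2 := wNorm_add_le hQ (yb (n + (n + k))) (yh (n + (n + k)) - yb (n + (n + k))) hη
        rw [add_sub_cancel] at h2
        have h3 := hQ' (yh (n + (n + k)) - yb (n + (n + k)))
        have h4 := mul_le_mul_of_nonneg_left (hyerr (n + (n + k)) (by omega)) hq.le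
        have h5 := mul_le_mul_of_nonneg_left (h3.trans h4) (show 0 ≤ 1 + η⁻¹ by positivity)
        have h6 := mul_nonneg hη.le (wNorm_nonneg hR (ub (n + (n + k))))
        have h7 : 0 ≤ (r + q) * f * E := by positivity
        simp only [g, hD]
        linarith
      · have h2 := hpost _ h
        have h3 := mul_le_mul_of_nonneg_left (h2.1.trans hdE) hr.le
        have h4 := mul_le_mul_of_nonneg_left (h2.2.trans hdE) hq.le
        have h5 := hR' (u' (n + k))
        have h6 := hQ' (y' (n + k))
        have h7 : 0 ≤ (1 + η⁻¹) * (q * b) * E := by positivity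
        have h8 : 0 ≤ (1 + η) * g (n + k) := mul_nonneg (by positivity) (hg0 _)
        rw [hD]
        linarith
    refine (Finset.sum_le_sum h1).trans (le_of_eq ?_)
    rw [Finset.sum_add_distrib, ← Finset.mul_sum, sum_shift_eq_sub hgL]
    simp
  have hioss : γ * wNorm P (stack (window n u n) (window n y n)) ≤
      γ * wNorm P (stack (window n u 0) (window n y 0)) - γ / 2 * X +
        (∑ k ∈ Finset.range n, g k + n * (γ * (2 * c₂) * b * E)) := by
    have h1 := mul_le_mul_of_nonneg_left (hP.multistep hstep hn) hγ.le
    have h2 : γ * ∑ i ∈ Finset.range n, (c₁ * sqNorm (u (n + i)) + c₂ * sqNorm (y (n + i))) ≤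
        ∑ k ∈ Finset.range n, g k + n * (γ * (2 * c₂) * b * E) := by
      rw [Finset.mul_sum]
      have h3 : ∀ i ∈ Finset.range n,
          γ * (c₁ * sqNorm (u (n + i)) + c₂ * sqNorm (y (n + i))) ≤
            g i + γ * (2 * c₂) * b * E := by
        intro i hi
        have hi := Finset.mem_range.1 hi
        have h4 := hγR (ub (n + i))
        have h5 := hγQ (yb (n + i))
        -- The IOSS supply contains the true output, the stage cost the predicted one. Splitting the
        -- former costs the factor two in the condition on `Q`.
        have h6 := sqNorm_add_le (yb (n + i)) (yh (n + i) - yb (n + i))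
        rw [add_sub_cancel] at h6
        have h7 := hyerr (n + i) (by omega)
        rw [hyh _ (by omega)] at h6 h7
        rw [huu _ (by omega)] at h4
        have h8 : γ * c₂ * sqNorm (y (n + i)) ≤
            γ * c₂ * (2 * sqNorm (yb (n + i)) + 2 * (b * E)) :=
          mul_le_mul_of_nonneg_left (by linarith) (by positivity)
        have h9 : g i = wNorm R (u (n + i)) + wNorm Q (yb (n + i)) := by
          simp only [g]
          rw [huu _ (by omega)]
        rw [h9]
        linarith
      refine (Finset.sum_le_sum h3).trans (le_of_eq ?_)
      rw [Finset.sum_add_distrib]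
      simp
    linarith
  have henergy : ∑ i ∈ Finset.range (n + L), sqNorm (u' i) ≤
      (γ * c₁)⁻¹ * S.cost z + (n + L) * (f * E) := by
    have h1 : ∀ i ∈ Finset.range (n + L), sqNorm (u' i) ≤ (γ * c₁)⁻¹ * g i + f * E := by
      intro i _
      rcases Nat.lt_or_ge i (L - n) with h | h
      · rw [(hpre _ h).1]
        have h2 := hγR (ub (n + i))
        have h3 : sqNorm (ub (n + i)) ≤ (γ * c₁)⁻¹ * g i := by
          rw [inv_mul_eq_div, le_div_iff₀ (by positivity)]
          have := wNorm_nonneg hQ (yb (n + i))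
          simp only [g]
          linarith
        linarith
      · have h2 := (hpost _ h).1.trans hdE
        have h3 : 0 ≤ (γ * c₁)⁻¹ * g i := mul_nonneg (by positivity) (hg0 i)
        linarith
    refine (Finset.sum_le_sum h1).trans ?_
    rw [Finset.sum_add_distrib, ← Finset.mul_sum, add_comm n L, Finset.sum_range_add,
      Finset.sum_eq_zero (s := Finset.range n) fun i _ => hgL _ (by omega)]
    have h2 : ∑ i ∈ Finset.range L, g i + 0 ≤ S.cost z := by linarith
    have h3 := mul_le_mul_of_nonneg_left h2 (show 0 ≤ (γ * c₁)⁻¹ by positivity)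
    have h4 : ∑ i ∈ Finset.range (L + n), f * E = (n + L) * (f * E) := by
      rw [Finset.sum_const, Finset.card_range, nsmul_eq_mul]
      push_cast
      ring
    linarith
  have hxn : sqNorm (x' 0) ≤ w * X := by
    rw [hx'0]
    exact (hwin u x y fun k _ => hstep k).2
  have hcost0 : 0 ≤ S.cost z := by
    rw [hstage]
    exact add_nonneg (Finset.sum_nonneg fun i _ => hg0 i) hreg0
  set K := f / ρ + (L * D + n * (γ * (2 * c₂) * b)) + ((γ * c₁)⁻¹ + (n + L) * f + w) with hK
  have hregb : S.regGain L N xd * (∑ i ∈ Finset.range (n + L), sqNorm (u' i) + sqNorm (x' 0)) ≤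
      S.regGain L N xd * (K * (S.cost z + E + X)) := by
    refine mul_le_mul_of_nonneg_left ?_ (regGain_nonneg hα hσ hS.pos.le L N xd)
    have k1 : (γ * c₁)⁻¹ * S.cost z ≤ K * S.cost z := by
      refine mul_le_mul_of_nonneg_right ?_ hcost0
      have : 0 ≤ f / ρ + (L * D + n * (γ * (2 * c₂) * b)) + ((n + L) * f + w) := by positivity
      linarith
    have k2 : (n + L) * f * E ≤ K * E := by
      refine mul_le_mul_of_nonneg_right ?_ hE0
      have : 0 ≤ f / ρ + (L * D + n * (γ * (2 * c₂) * b)) + ((γ * c₁)⁻¹ + w) := by positivity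
      linarith
    have k3 : w * X ≤ K * X := by
      refine mul_le_mul_of_nonneg_right ?_ hX0
      have : 0 ≤ f / ρ + (L * D + n * (γ * (2 * c₂) * b)) + ((γ * c₁)⁻¹ + (n + L) * f) := by
        positivity
      linarith
    linarith
  have hKE : (L * D + n * (γ * (2 * c₂) * b)) * E ≤ K * E := by
    refine mul_le_mul_of_nonneg_right ?_ hE0
    have : 0 ≤ f / ρ + ((γ * c₁)⁻¹ + (n + L) * f + w) := by positivity
    linarith
  have hcand' : (1 + η) * (∑ k ∈ Finset.range L, g k - ∑ k ∈ Finset.range n, g k) ≤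
      ∑ k ∈ Finset.range L, g k - ∑ k ∈ Finset.range n, g k + η * S.cost z := by
    have h1 : 0 ≤ ∑ k ∈ Finset.range n, g k := Finset.sum_nonneg fun i _ => hg0 i
    have h2 := mul_le_mul_of_nonneg_left
      (show ∑ k ∈ Finset.range L, g k - ∑ k ∈ Finset.range n, g k ≤ S.cost z by linarith) hη.le
    linarith
  unfold regGain at hregb ⊢
  linarith

end Scheme

end DDMPC

/-! ### Existence of optimal solutions -/

namespace DDMPC

variable {n m p L N : ℕ}

lemma continuous_sqNorm {ι : Type*} [Fintype ι] : Continuous (sqNorm : (ι → ℝ) → ℝ) := by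
  unfold sqNorm
  fun_prop

lemma continuous_wNorm {ι : Type*} [Fintype ι] (P : Matrix ι ι ℝ) :
    Continuous (wNorm P : (ι → ℝ) → ℝ) := by
  unfold wNorm
  fun_prop

lemma continuous_l1Norm {ι : Type*} [Fintype ι] : Continuous (l1Norm : (ι → ℝ) → ℝ) := by
  unfold l1Norm
  fun_prop

lemma continuous_comb {q M : ℕ} (v : ℕ → Fin q → ℝ) (i : ℕ) :
    Continuous (fun α : Fin M → ℝ => comb v α i) := by
  unfold comb
  fun_prop

lemma abs_le_of_mul_sqNorm_le {ι : Type*} [Fintype ι] {c b : ℝ} (hc : 0 < c) {v : ι → ℝ}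
    (h : c * sqNorm v ≤ b) (i : ι) : |v i| ≤ 1 + b / c := by
  have h1 : sqNorm v ≤ b / c := by rwa [le_div_iff₀ hc, mul_comm]
  have h2 := (sq_le_sqNorm v i).trans h1
  rw [← sq_abs] at h2
  nlinarith [sq_nonneg (|v i| - 1), abs_nonneg (v i)]

namespace Scheme

/-- The decision determined by the coefficients and the slack. -/
def decisionOf (S : Scheme m p)
    (w : (Fin (N + 1 - (n + L)) → ℝ) × (Fin (n + L) → Fin p → ℝ)) : Decision n m p L N where
  α := w.1
  σ := w.2
  ubar := fun i => comb S.ud w.1 i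
  ybar := fun i => comb S.yd w.1 i - w.2 i

/-- The model equations eliminate the predicted inputs and outputs, so minimization takes place over
the pairs `(α, σ)`. -/
lemma Feasible.eq_decisionOf {S : Scheme m p} {up : Fin n → Fin m → ℝ} {yp : Fin n → Fin p → ℝ}
    {z : Decision n m p L N} (hz : S.Feasible up yp z) : S.decisionOf (z.α, z.σ) = z := by
  obtain ⟨α, σ, ub, yb⟩ := z
  have h1 : ub = fun i : Fin (n + L) => comb S.ud α i := by
    funext i a
    rw [← hankel_mulVec (d := n + L) (N := N)]
    exact hz.input_model i a
  have h2 : yb = fun i : Fin (n + L) => comb S.yd α i - σ i := by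
    funext i a
    have := hz.output_model i a
    rw [hankel_mulVec] at this
    exact eq_sub_of_add_eq this
  simp only [decisionOf, h1, h2]

lemma stageCost_nonneg {S : Scheme m p} (hQ : S.Q.PosDef) (hR : S.R.PosDef)
    (z : Decision n m p L N) :
    0 ≤ ∑ k : Fin L, (wNorm S.R (z.ubar (Fin.natAdd n k)) + wNorm S.Q (z.ybar (Fin.natAdd n k))) :=
  Finset.sum_nonneg fun _ _ => add_nonneg (wNorm_nonneg hR _) (wNorm_nonneg hQ _)

lemma regularization_le_cost {S : Scheme m p} (hQ : S.Q.PosDef) (hR : S.R.PosDef)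
    (z : Decision n m p L N) :
    S.lα * S.εbar * sqNorm z.α + S.lσ * ∑ i, sqNorm (z.σ i) ≤ S.cost z := by
  have := stageCost_nonneg hQ hR z
  unfold cost
  linarith

/-- Weierstrass on the feasible sublevel set of `z₀`: it is closed, and bounded because both
regularization weights are positive and the stage costs nonnegative. -/
lemma exists_optimal {S : Scheme m p} (hQ : S.Q.PosDef) (hR : S.R.PosDef) (hU : IsClosed S.U)
    (hα : 0 < S.lα) (hσ : 0 < S.lσ) (hε : 0 < S.εbar) {up : Fin n → Fin m → ℝ}
    {yp : Fin n → Fin p → ℝ} {z₀ : Decision n m p L N} (hz₀ : S.Feasible up yp z₀) :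
    ∃ z : Decision n m p L N, S.IsOptimal up yp z := by
  let E := (Fin (N + 1 - (n + L)) → ℝ) × (Fin (n + L) → Fin p → ℝ)
  have hub : ∀ i : Fin (n + L), Continuous fun w : E => (S.decisionOf w).ubar i := fun i =>
    (continuous_comb S.ud i).comp continuous_fst
  have hyb : ∀ i : Fin (n + L), Continuous fun w : E => (S.decisionOf w).ybar i := fun i =>
    ((continuous_comb S.yd i).comp continuous_fst).sub
      ((continuous_apply i).comp continuous_snd)
  have hσc : ∀ i : Fin (n + L), Continuous fun w : E => (S.decisionOf w).σ i := fun i =>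
    (continuous_apply i).comp continuous_snd
  have hαc : Continuous fun w : E => (S.decisionOf w).α := continuous_fst
  have hcost : Continuous fun w : E => S.cost (S.decisionOf w) := by
    unfold cost
    refine ((continuous_finsetSum _ fun k _ => ?_).add ?_).add ?_
    · exact ((continuous_wNorm _).comp (hub _)).add ((continuous_wNorm _).comp (hyb _))
    · exact continuous_const.mul (continuous_sqNorm.comp hαc)
    · exact continuous_const.mul
        (continuous_finsetSum _ fun i _ => continuous_sqNorm.comp (hσc i))
  have hclosed : IsClosed {w : E | S.Feasible up yp (S.decisionOf w)} := by
    have : {w : E | S.Feasible up yp (S.decisionOf w)} =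
        (⋂ i : Fin n, {w | (S.decisionOf w).ubar (Fin.castAdd L i) = up i}) ∩
        (⋂ i : Fin n, {w | (S.decisionOf w).ybar (Fin.castAdd L i) = yp i}) ∩
        (⋂ k : Fin L, ⋂ _ : L ≤ (k : ℕ) + n, {w | (S.decisionOf w).ubar (Fin.natAdd n k) = 0} ∩
          {w | (S.decisionOf w).ybar (Fin.natAdd n k) = 0}) ∩
        (⋂ k : Fin L, (fun w : E => (S.decisionOf w).ubar (Fin.natAdd n k)) ⁻¹' S.U) ∩
        (⋂ k : Fin L, ⋂ a : Fin p, {w | |(S.decisionOf w).σ (Fin.natAdd n k) a| ≤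
          S.εbar * (1 + l1Norm (S.decisionOf w).α)}) := by
      ext w
      simp only [Set.mem_ofPred_eq, Set.mem_inter_iff, Set.mem_iInter, Set.mem_preimage]
      constructor
      · intro h
        exact ⟨⟨⟨⟨h.input_init, h.output_init⟩, h.terminal⟩, h.input_constraint⟩, h.slack⟩
      · rintro ⟨⟨⟨⟨h1, h2⟩, h3⟩, h4⟩, h5⟩
        exact ⟨fun i a => rfl, fun i a => sub_add_cancel _ _, h1, h2, h3, h4, h5⟩
    rw [this]
    refine ((((isClosed_iInter fun i => isClosed_eq (hub _) continuous_const).inter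
      (isClosed_iInter fun i => isClosed_eq (hyb _) continuous_const)).inter
      (isClosed_iInter fun k => isClosed_iInter fun _ =>
        (isClosed_eq (hub _) continuous_const).inter (isClosed_eq (hyb _) continuous_const))).inter
      (isClosed_iInter fun k => hU.preimage (hub _))).inter
      (isClosed_iInter fun k => isClosed_iInter fun a => isClosed_le ?_ ?_)
    · exact ((continuous_apply a).comp (hσc _)).abs
    · exact continuous_const.mul (continuous_const.add (continuous_l1Norm.comp hαc))
  let c₀ := S.cost z₀
  let T : Set E := {w | S.Feasible up yp (S.decisionOf w)} ∩ {w | S.cost (S.decisionOf w) ≤ c₀}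
  have hαε : 0 < S.lα * S.εbar := mul_pos hα hε
  have hreg0 : ∀ z : Decision n m p L N, 0 ≤ S.lα * S.εbar * sqNorm z.α ∧
      0 ≤ S.lσ * ∑ i, sqNorm (z.σ i) := fun z =>
    ⟨mul_nonneg hαε.le (sqNorm_nonneg _),
      mul_nonneg hσ.le (Finset.sum_nonneg fun _ _ => sqNorm_nonneg _)⟩
  have hc₀ : 0 ≤ c₀ := (add_nonneg (hreg0 z₀).1 (hreg0 z₀).2).trans
    (regularization_le_cost hQ hR z₀)
  have hT : IsCompact T := by
    refine Metric.isCompact_of_isClosed_isBounded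
      (hclosed.inter (isClosed_le hcost continuous_const)) ?_
    refine (Metric.isBounded_closedBall (x := (0 : E))
      (r := (1 + c₀ / (S.lα * S.εbar)) + (1 + c₀ / S.lσ))).subset fun w hw => ?_
    rw [mem_closedBall_zero_iff]
    have h1 := (regularization_le_cost hQ hR (S.decisionOf w)).trans hw.2
    obtain ⟨h2, h3⟩ := hreg0 (S.decisionOf w)
    have k1 : 0 ≤ 1 + c₀ / (S.lα * S.εbar) := by positivity
    have k2 : 0 ≤ 1 + c₀ / S.lσ := by positivity
    refine norm_prod_le_iff.2 ⟨?_, ?_⟩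
    · refine (pi_norm_le_iff_of_nonneg (by positivity)).2 fun j => ?_
      have := abs_le_of_mul_sqNorm_le hαε (v := w.1) (b := c₀) (by
        change S.lα * S.εbar * sqNorm (S.decisionOf w).α ≤ c₀
        linarith) j
      rw [Real.norm_eq_abs]
      linarith
    · refine (pi_norm_le_iff_of_nonneg (by positivity)).2 fun i =>
        (pi_norm_le_iff_of_nonneg (by positivity)).2 fun a => ?_
      have h4 := Finset.single_le_sum (f := fun i => sqNorm ((S.decisionOf w).σ i))
        (fun i _ => sqNorm_nonneg _) (Finset.mem_univ i)
      have h5 := mul_le_mul_of_nonneg_left h4 hσ.le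
      have := abs_le_of_mul_sqNorm_le hσ (v := w.2 i) (b := c₀) (by
        change S.lσ * sqNorm ((S.decisionOf w).σ i) ≤ c₀
        linarith) a
      rw [Real.norm_eq_abs]
      linarith
  have hw₀ : ((z₀.α, z₀.σ) : E) ∈ T := by
    refine ⟨?_, ?_⟩
    · rw [Set.mem_ofPred_eq, hz₀.eq_decisionOf]
      exact hz₀
    · rw [Set.mem_ofPred_eq, hz₀.eq_decisionOf]
  obtain ⟨w, hw, hmin⟩ := hT.exists_isMinOn ⟨_, hw₀⟩ hcost.continuousOn
  refine ⟨S.decisionOf w, hw.1, fun z hz => ?_⟩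
  rcases le_total (S.cost z) c₀ with h | h
  · have h1 : ((z.α, z.σ) : E) ∈ T := by
      refine ⟨?_, ?_⟩
      · rw [Set.mem_ofPred_eq, hz.eq_decisionOf]
        exact hz
      · rw [Set.mem_ofPred_eq, hz.eq_decisionOf]
        exact h
    have h2 : S.cost (S.decisionOf w) ≤ S.cost (S.decisionOf (z.α, z.σ)) := hmin h1
    rwa [hz.eq_decisionOf] at h2
  · exact hw.2.trans h

lemma optCost_le {S : Scheme m p} {up : Fin n → Fin m → ℝ} {yp : Fin n → Fin p → ℝ}
    {z : Decision n m p L N} (hz : S.Feasible up yp z) :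
    S.optCost L N up yp ≤ ((S.cost z : ℝ) : EReal) :=
  iInf₂_le z hz

lemma IsOptimal.optCost_eq {S : Scheme m p} {up : Fin n → Fin m → ℝ} {yp : Fin n → Fin p → ℝ}
    {z : Decision n m p L N} (hz : S.IsOptimal up yp z) :
    S.optCost L N up yp = ((S.cost z : ℝ) : EReal) :=
  le_antisymm (optCost_le hz.1) (le_iInf₂ fun w hw => EReal.coe_le_coe_iff.2 (hz.2 w hw))

lemma exists_feasible_of_optCost_ne_top {S : Scheme m p} {up : Fin n → Fin m → ℝ}
    {yp : Fin n → Fin p → ℝ} (h : S.optCost L N up yp ≠ ⊤) :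
    ∃ z : Decision n m p L N, S.Feasible up yp z := by
  by_contra! hc
  exact h (iInf₂_eq_top.2 fun z hz => (hc z hz).elim)

end Scheme

end DDMPC

/-! ### The contraction estimate and the choice of constants -/

namespace DDMPC

variable {n m p L N : ℕ}

namespace Scheme

/-- One step of the scheme contracts the Lyapunov function candidate up to a noise term. -/
lemma exists_contraction (hn : 0 < n) (hL : 2 * n ≤ L) (N : ℕ) (G : LTI n m p) (hG : G.IsMinimal)
    {Q : Matrix (Fin p) (Fin p) ℝ} (hQ : Q.PosDef) {R : Matrix (Fin m) (Fin m) ℝ} (hR : R.PosDef)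
    {U : Set (Fin m → ℝ)} (hU : (0 : Fin m → ℝ) ∈ interior U)
    {P : Matrix ((Fin n × Fin m) ⊕ (Fin n × Fin p)) ((Fin n × Fin m) ⊕ (Fin n × Fin p)) ℝ}
    {c₁ c₂ : ℝ} (hP : IsIOSS G P c₁ c₂) {γ : ℝ} (hγ : 0 < γ)
    (hγR : ∀ v : Fin m → ℝ, γ * c₁ * sqNorm v ≤ wNorm R v)
    (hγQ : ∀ v : Fin p → ℝ, γ * (2 * c₂) * sqNorm v ≤ wNorm Q v) {v₀ : ℝ} (hv₀ : 0 < v₀) :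
    ∃ lσ_min : ℝ, 0 < lσ_min ∧ ∀ lα lσ : ℝ, 1 ≤ lα → lσ_min ≤ lσ →
      ∃ ε₀ cpe_max θ M : ℝ, 0 < ε₀ ∧ 0 < cpe_max ∧ 0 < θ ∧ θ < 1 ∧ 0 < M ∧
        M * ε₀ ^ 2 ≤ θ * v₀ ∧
      ∀ (S : Scheme m p) (xd : ℕ → Fin n → ℝ) (yd εd : ℕ → Fin p → ℝ),
      S.HasData G L N xd yd εd → S.Q = Q → S.R = R → S.U = U → S.lα = lα → S.lσ = lσ →
      S.εbar ≤ ε₀ → cpe L N S.ud xd * S.εbar ≤ cpe_max →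
      ∀ (u : ℕ → Fin m → ℝ) (x : ℕ → Fin n → ℝ) (y ε : ℕ → Fin p → ℝ) (z : Decision n m p L N),
      (∀ k, G.StepAt u x y k) → (∀ k a, |ε k a| ≤ S.εbar) →
      S.IsOptimal (window n u 0) (window n (y + ε) 0) z →
      (∀ k : Fin L, (k : ℕ) < n → u (n + (k : ℕ)) = z.ubar (Fin.natAdd n k)) →
      S.cost z + γ * wNorm P (stack (window n u 0) (window n y 0)) ≤ v₀ →
      ∃ z' : Decision n m p L N, S.Feasible (window n u n) (window n (y + ε) n) z' ∧
        S.cost z' + γ * wNorm P (stack (window n u n) (window n y n)) ≤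
          (1 - θ) * (S.cost z + γ * wNorm P (stack (window n u 0) (window n y 0))) +
            M * S.εbar ^ 2 := by
  obtain ⟨r, Cl, hr, hCl, hloc⟩ := exists_local_bound hn hL N G hG Q R U hU
  obtain ⟨Λ, hΛ, hPΛ⟩ := exists_wNorm_le P
  -- The first two terms serve near the origin and `v₀ / r` outside the ball; the rest ensures `CV ≥
  -- 1` and `CV ≥ γ`.
  set CV := Cl + γ * Λ + v₀ / r + γ + 1 with hCV
  have hCV0 : 0 < CV := by positivity
  have hCV1 : 1 ≤ CV := by
    have : 0 ≤ Cl + γ * Λ + v₀ / r + γ := by positivity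
    linarith
  have hCVγ : γ ≤ CV := by
    have : 0 ≤ Cl + γ * Λ + v₀ / r + 1 := by positivity
    linarith
  obtain ⟨C, hC, hdecr⟩ := exists_step_bound hn hL N G hG hQ hR hU hP hγ hγR hγQ
    (η := γ / (8 * CV)) (by positivity)
  -- The part `2 C` lets the slack penalty absorb the slack in the mismatch; the part `2 C v₀` makes
  -- that slack small whenever the cost is at most `v₀`.
  refine ⟨2 * C * (1 + v₀), by positivity, fun lα lσ hlα hlσ => ?_⟩
  have hlα0 : 0 < lα := by linarith
  have hlσ0 : 0 < lσ := lt_of_lt_of_le (by positivity) hlσ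
  set A : ℝ := 2 * (n + L) * p with hA
  have hA0 : 0 ≤ A := by positivity
  set κ := min 1 (γ / (16 * C * CV)) with hκ
  have hκ0 : 0 < κ := lt_min one_pos (by positivity)
  set θ := γ / (4 * CV) with hθ
  have hθ0 : 0 < θ := by positivity
  have hθCV : θ * CV = γ / 4 := by rw [hθ]; field_simp
  have hθ1 : θ ≤ 1 / 4 := by
    rw [hθ, div_le_iff₀ (by positivity)]
    linarith
  set M := 3 * (lσ * A) + 2 * C with hM
  have hM0 : 0 < M := by positivity
  -- Each summand gives one bound on `ε̄`: `ε̄ ≤ 1`, absorption of the `α`-part of the mismatch by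
  -- its penalty, smallness of that part, and invariance of the sublevel set.
  set Den := 1 + 2 * C * N + 2 * C * (1 + N * v₀) + M / (θ * v₀) with hDen
  have hDen0 : 0 < Den := by positivity
  refine ⟨Den⁻¹, κ / (lα + lσ * (A * N)), θ, M, by positivity, by positivity, hθ0,
    by linarith, hM0, ?_, ?_⟩
  · have h1 : Den⁻¹ ≤ 1 := by
      apply inv_le_one_of_one_le₀
      have : 0 ≤ 2 * C * N + 2 * C * (1 + N * v₀) + M / (θ * v₀) := by positivity
      linarith
    have h2 : M / (θ * v₀) * Den⁻¹ ≤ 1 := by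
      rw [← div_eq_mul_inv, div_le_one hDen0]
      have : 0 ≤ 1 + 2 * C * N + 2 * C * (1 + N * v₀) := by positivity
      linarith
    have h3 : M * Den⁻¹ ≤ θ * v₀ := by
      rwa [div_mul_eq_mul_div, div_le_one (by positivity)] at h2
    have h4 : M * Den⁻¹ * Den⁻¹ ≤ θ * v₀ * 1 :=
      mul_le_mul h3 h1 (by positivity) (by positivity)
    linarith [show M * Den⁻¹ ^ 2 = M * Den⁻¹ * Den⁻¹ by ring]
  intro S xd yd εd hS hSQ hSR hSU hSα hSσ hSε hSc u x y ε z hstep hε hz happ hV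
  have hε0 := hS.pos
  set e := S.εbar with he
  have heDen : e * Den ≤ 1 := by
    have := mul_le_mul_of_nonneg_right hSε hDen0.le
    rwa [inv_mul_cancel₀ hDen0.ne'] at this
  have hα0 : 0 ≤ S.lα := by rw [hSα]; exact hlα0.le
  have hσ0 : 0 ≤ S.lσ := by rw [hSσ]; exact hlσ0.le
  have hSQ' : S.Q.PosDef := by rwa [hSQ]
  have hSR' : S.R.PosDef := by rwa [hSR]
  have he1 : e ≤ 1 := by
    have : 0 ≤ e * (2 * C * N + 2 * C * (1 + N * v₀) + M / (θ * v₀)) := by positivity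
    linarith
  have he2 : 2 * C * N * e ≤ 1 := by
    have : 0 ≤ e * (1 + 2 * C * (1 + N * v₀) + M / (θ * v₀)) := by positivity
    linarith
  have he3 : 2 * C * (1 + N * v₀) * e ≤ 1 := by
    have : 0 ≤ e * (1 + 2 * C * N + M / (θ * v₀)) := by positivity
    linarith
  set k := S.regGain L N xd with hk
  have hk0 : 0 ≤ k := regGain_nonneg hα0 hσ0 hε0.le L N xd
  have hkκ : k ≤ κ := by
    have h1 : k = (lα + lσ * (A * N) * e) * (cpe L N S.ud xd * e) := by
      rw [hk, regGain, hSα, hSσ, hA]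
      ring
    have h2 : lα + lσ * (A * N) * e ≤ lα + lσ * (A * N) := by
      have : lσ * (A * N) * e ≤ lσ * (A * N) * 1 := mul_le_mul_of_nonneg_left he1 (by positivity)
      linarith
    rw [h1]
    refine (mul_le_mul h2 hSc (mul_nonneg (cpe_nonneg L N S.ud xd) hε0.le) (by positivity)).trans
      (le_of_eq ?_)
    field_simp
  have hk1 : k ≤ 1 := hkκ.trans (min_le_left _ _)
  have hkC : k * C * CV ≤ γ / 16 := by
    have h1 : k * (16 * C * CV) ≤ γ := by
      rw [← le_div_iff₀ (by positivity)]
      exact hkκ.trans (min_le_right _ _)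
    linarith
  set X := sqNorm (stack (window n u 0) (window n y 0)) with hX
  have hX0 : 0 ≤ X := sqNorm_nonneg _
  set W := wNorm P (stack (window n u 0) (window n y 0)) with hW
  have hW0 : 0 ≤ γ * W := mul_nonneg hγ.le (wNorm_nonneg hP.1 _)
  set V := S.cost z + γ * W with hVdef
  set a := lσ * A * e ^ 2 with ha
  have ha0 : 0 ≤ a := by positivity
  have hVX : V ≤ CV * X + a := by
    rcases le_or_gt X r with h | h
    · obtain ⟨z', hz', hc'⟩ := hloc S xd yd εd hS hSQ hSR hSU hα0 hσ0 hk1 u x y (fun i => ε i)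
        (fun k _ => hstep k) (fun i b => hε _ _) h
      have h1 : S.cost z ≤ S.cost z' := hz.2 z' (by
        convert hz' using 1 <;> funext i <;> simp [window])
      have h2 := mul_le_mul_of_nonneg_left (hPΛ (stack (window n u 0) (window n y 0))) hγ.le
      rw [hSσ] at hc'
      have h3 : 0 ≤ (v₀ / r + γ + 1) * X := by positivity
      rw [hVdef, hCV]
      linarith
    · have h1 : v₀ ≤ v₀ / r * X := by
        rw [div_mul_eq_mul_div, le_div_iff₀ hr]
        exact mul_le_mul_of_nonneg_left h.le hv₀.le
      have h3 : 0 ≤ (Cl + γ * Λ + γ + 1) * X := by positivity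
      rw [hCV]
      linarith
  set s := ∑ i, sqNorm (z.σ i) with hs
  have hs0 : 0 ≤ s := Finset.sum_nonneg fun _ _ => sqNorm_nonneg _
  set q := sqNorm z.α with hq
  have hq0 : 0 ≤ q := sqNorm_nonneg _
  have hreg : lα * e * q + lσ * s ≤ S.cost z := by
    have := regularization_le_cost hSQ' hSR' z
    rwa [hSα, hSσ] at this
  have hαq : 0 ≤ lα * e * q := by positivity
  have hσs : 0 ≤ lσ * s := by positivity
  have hmis : S.mismatch z = s + e ^ 2 * (1 + N * q) := rfl
  have heq : e * q ≤ v₀ := by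
    have h1 : 1 * (e * q) ≤ lα * (e * q) := mul_le_mul_of_nonneg_right hlα (by positivity)
    linarith
  have hCE : C * S.mismatch z ≤ 1 := by
    have h1 : C * s ≤ 1 / 2 := by
      have h2 : 2 * C * (1 + v₀) * s ≤ v₀ := by
        have := mul_le_mul_of_nonneg_right hlσ hs0
        linarith
      have h3 : (C * s) * (1 + v₀) ≤ 1 / 2 * (1 + v₀) := by linarith
      exact le_of_mul_le_mul_right h3 (by positivity)
    have h4 : e + N * (e * q) ≤ 1 + N * v₀ :=
      add_le_add he1 (mul_le_mul_of_nonneg_left heq (Nat.cast_nonneg _))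
    have h5 := mul_le_mul_of_nonneg_left h4 (show 0 ≤ C * e by positivity)
    rw [hmis]
    linarith
  obtain ⟨z', hz', hc'⟩ := hdecr S xd yd εd hS hSQ hSR hSU hα0 hσ0 u x y ε z hstep hε hz.1 happ hCE
  refine ⟨z', hz', hc'.trans ?_⟩
  rw [hSα, hSσ, hmis]
  have hcV : S.cost z ≤ V := by linarith
  have hc0 : 0 ≤ S.cost z := by linarith
  -- The dissipation `γ/2 X` is spent exactly: `1/8` on the Young remainder (`t1`), `1/16 + 1/16` on
  -- the regularization of the candidate (`t2`, `t3`), and `1/4` on the contraction (`t5`). The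
  -- multiples of `a` left over are covered by `3 a`.
  have t1 : γ / (8 * CV) * S.cost z ≤ γ / 8 * X + a / 8 := by
    have h1 : γ / (8 * CV) * S.cost z ≤ γ / (8 * CV) * (CV * X + a) :=
      mul_le_mul_of_nonneg_left (hcV.trans hVX) (by positivity)
    have h2 : γ / (8 * CV) * (CV * X + a) = γ / 8 * X + γ / CV * a / 8 := by field_simp
    have h3 : γ / CV * a ≤ 1 * a :=
      mul_le_mul_of_nonneg_right ((div_le_one hCV0).2 hCVγ) ha0
    linarith
  have hkC0 : 0 ≤ k * C := by positivity
  have hkC1 : k * C ≤ γ / 16 := by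
    have : k * C * 1 ≤ k * C * CV := mul_le_mul_of_nonneg_left hCV1 hkC0
    linarith
  have t2 : k * C * S.cost z ≤ γ / 16 * X + a / 16 := by
    have h1 : k * C * S.cost z ≤ k * C * (CV * X + a) :=
      mul_le_mul_of_nonneg_left (hcV.trans hVX) hkC0
    have h2 : k * C * CV * X ≤ γ / 16 * X := mul_le_mul_of_nonneg_right hkC hX0
    have h3 : k * C ≤ 1 / 16 := by
      have h4 : (k * C) * CV ≤ 1 / 16 * CV := by linarith
      exact le_of_mul_le_mul_right h4 hCV0
    have h5 : k * C * a ≤ 1 / 16 * a := mul_le_mul_of_nonneg_right h3 ha0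
    linarith
  have t3 : k * C * X ≤ γ / 16 * X := mul_le_mul_of_nonneg_right hkC1 hX0
  -- Here the regularization of the old solution pays for the mismatch, up to a pure noise term.
  have t4 : C * (s + e ^ 2 * (1 + N * q)) + k * C * (s + e ^ 2 * (1 + N * q)) ≤
      lα * e * q + lσ * s + 2 * C * e ^ 2 := by
    have h0 : 0 ≤ C * (s + e ^ 2 * (1 + N * q)) := by positivity
    have h1 : k * (C * (s + e ^ 2 * (1 + N * q))) ≤ 1 * (C * (s + e ^ 2 * (1 + N * q))) :=
      mul_le_mul_of_nonneg_right hk1 h0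
    have h2 : 2 * C * s ≤ lσ * s := by
      refine mul_le_mul_of_nonneg_right (le_trans ?_ hlσ) hs0
      have : 0 ≤ 2 * C * v₀ := by positivity
      linarith
    have h3 : 2 * C * N * e * (e * q) ≤ lα * (e * q) :=
      mul_le_mul_of_nonneg_right (he2.trans hlα) (by positivity)
    linarith
  have t5 : θ * V ≤ γ / 4 * X + a / 4 := by
    have h1 := mul_le_mul_of_nonneg_left hVX hθ0.le
    have h2 : θ * a ≤ 1 / 4 * a := mul_le_mul_of_nonneg_right hθ1 ha0
    have h3 : θ * (CV * X) = γ / 4 * X := by rw [← mul_assoc, hθCV]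
    linarith
  have t6 : M * e ^ 2 = 3 * a + 2 * C * e ^ 2 := by rw [hM, ha]; ring
  rw [t6]
  linarith

end Scheme

end DDMPC

/-! ### The closed loop -/

theorem theorem3 (n m p L N : ℕ) (hn : 0 < n) (hL : 2 * n ≤ L)
    (G : DDMPC.LTI n m p) (hG : G.IsMinimal)
    (Q : Matrix (Fin p) (Fin p) ℝ) (hQ : Q.PosDef)
    (R : Matrix (Fin m) (Fin m) ℝ) (hR : R.PosDef)
    (U : Set (Fin m → ℝ)) (hU : (0 : Fin m → ℝ) ∈ interior U) :
    -- an IOSS Lyapunov function of the extended state exists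
    (∃ (P : Matrix ((Fin n × Fin m) ⊕ (Fin n × Fin p)) ((Fin n × Fin m) ⊕ (Fin n × Fin p)) ℝ)
      (c₁ c₂ : ℝ), DDMPC.IsIOSS G P c₁ c₂) ∧
    -- and for each of them, and each admissible weight `γ`, the claim holds
    ∀ (P : Matrix ((Fin n × Fin m) ⊕ (Fin n × Fin p)) ((Fin n × Fin m) ⊕ (Fin n × Fin p)) ℝ)
      (c₁ c₂ : ℝ), DDMPC.IsIOSS G P c₁ c₂ →
    ∀ γ : ℝ, 0 < γ →
      (∀ v : Fin m → ℝ, γ * c₁ * DDMPC.sqNorm v ≤ DDMPC.wNorm R v) →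
      (∀ v : Fin p → ℝ, γ * (2 * c₂) * DDMPC.sqNorm v ≤ DDMPC.wNorm Q v) →
    ∀ V_ROA : ℝ, 0 < V_ROA →
    ∃ lα_min lα_max lσ_min lσ_max : ℝ,
      0 < lα_min ∧ lα_min < lα_max ∧ 0 < lσ_min ∧ lσ_min < lσ_max ∧
    ∀ lα ∈ Set.Icc lα_min lα_max, ∀ lσ ∈ Set.Icc lσ_min lσ_max,
    ∃ (ε₀ cpe_max : ℝ) (β : ℝ → ℝ) (c : ℝ),
      0 < ε₀ ∧ 0 < cpe_max ∧ 0 < c ∧ c < 1 ∧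
      ContinuousOn β (Set.Icc 0 ε₀) ∧ StrictMonoOn β (Set.Icc 0 ε₀) ∧ β 0 = 0 ∧
      Set.MapsTo β (Set.Icc 0 ε₀) (Set.Icc 0 V_ROA) ∧
    ∀ εbar : ℝ, 0 < εbar → εbar ≤ ε₀ →
    -- the data: an exact trajectory with a persistently exciting input, measured with noise `εd`
    ∀ (ud : ℕ → Fin m → ℝ) (xd : ℕ → Fin n → ℝ) (yd εd : ℕ → Fin p → ℝ),
      (∀ k < N, G.StepAt ud xd yd k) →
      DDMPC.PersistentlyExciting (L + 2 * n) N ud →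
      (∀ k < N, ∀ a, |εd k a| ≤ εbar) →
      DDMPC.cpe L N ud xd * εbar ≤ cpe_max →
    -- the closed loop, run for `K` steps of the scheme, with online measurement noise `ε`
    ∀ (u : ℕ → Fin m → ℝ) (x : ℕ → Fin n → ℝ) (y ε : ℕ → Fin p → ℝ) (K : ℕ),
      (∀ k, G.StepAt u x y k) →
      (∀ k a, |ε k a| ≤ εbar) →
      let S : DDMPC.Scheme m p :=
        { Q := Q, R := R, U := U, lα := lα, lσ := lσ, εbar := εbar, ud := ud, yd := yd + εd }
      (∀ j < K, S.MPCStep n L N u y ε j) →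
      S.V L N γ P u y ε 0 ≤ (V_ROA : EReal) →
        -- invariance of the sublevel set (in particular feasibility)
        S.V L N γ P u y ε (K * n) ≤ (V_ROA : EReal) ∧
        -- exponential convergence to the sublevel set `V ≤ β εbar`
        S.V L N γ P u y ε (K * n) ≤
          ((β εbar + c ^ K * max ((S.V L N γ P u y ε 0).toReal - β εbar) 0 : ℝ) : EReal) ∧
        -- the next optimization problem has an optimal solution, so the scheme can be continued
        (IsClosed U → ∃ z : DDMPC.Decision n m p L N,
          S.IsOptimal (DDMPC.window n u (K * n)) (DDMPC.window n (y + ε) (K * n)) z) := by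
  refine ⟨DDMPC.exists_isIOSS hn G, fun P c₁ c₂ hP γ hγ hγR hγQ v₀ hv₀ => ?_⟩
  obtain ⟨lσ_min, hlσ_min, hcontr⟩ :=
    DDMPC.Scheme.exists_contraction hn hL N G hG hQ hR hU hP hγ hγR hγQ hv₀
  -- The contraction needs only lower bounds on the weights; the upper ends are arbitrary.
  refine ⟨1, 2, lσ_min, lσ_min + 1, one_pos, one_lt_two, hlσ_min, by linarith, ?_⟩
  intro lα hlα lσ hlσ
  obtain ⟨ε₀, cpe_max, θ, M, hε₀, hcpe, hθ0, hθ1, hM, hMε, hstepc⟩ := hcontr lα lσ hlα.1 hlσ.1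
  have hMθ : 0 < M / θ := div_pos hM hθ0
  -- `M / θ * e ^ 2` is the fixed point of `v ↦ (1 - θ) v + M e²`.
  have hβmono : StrictMonoOn (fun e : ℝ => M / θ * e ^ 2) (Set.Icc 0 ε₀) := by
    intro a ha b _ hab
    exact mul_lt_mul_of_pos_left (pow_lt_pow_left₀ hab ha.1 two_ne_zero) hMθ
  have hβmax : M / θ * ε₀ ^ 2 ≤ v₀ := by
    rw [div_mul_eq_mul_div, div_le_iff₀ hθ0]
    linarith
  refine ⟨ε₀, cpe_max, fun e => M / θ * e ^ 2, 1 - θ, hε₀, hcpe, by linarith, by linarith,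
    by fun_prop, hβmono, by simp, fun e he => ⟨by positivity, ?_⟩, ?_⟩
  · exact (mul_le_mul_of_nonneg_left (pow_le_pow_left₀ he.1 he.2 2) hMθ.le).trans hβmax
  intro εbar hε hεε₀ ud xd yd εd hdata hpe hεd hcpeε u x y ε K hstep hnoise S hrun hV0
  have hS : S.HasData G L N xd yd εd := ⟨hdata, hpe, rfl, hεd, hε⟩
  set β := M / θ * εbar ^ 2 with hβ
  have hβθ : M * εbar ^ 2 = θ * β := by rw [hβ]; field_simp
  have hβv : β ≤ v₀ :=
    (mul_le_mul_of_nonneg_left (pow_le_pow_left₀ hε.le hεε₀ 2) hMθ.le).trans hβmax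
  set d := max ((S.V L N γ P u y ε 0).toReal - β) 0 with hd
  -- Both bounds go through one induction, since each contraction step requires the invariance
  -- reached so far.
  have key : ∀ j ≤ K, S.V L N γ P u y ε (j * n) ≤ (v₀ : EReal) ∧
      S.V L N γ P u y ε (j * n) ≤ ((β + (1 - θ) ^ j * d : ℝ) : EReal) := by
    intro j
    induction j with
    | zero =>
      intro _
      rw [zero_mul]
      refine ⟨hV0, (EReal.le_coe_toReal (ne_top_of_le_ne_top (EReal.coe_ne_top v₀) hV0)).trans ?_⟩
      rw [EReal.coe_le_coe_iff, pow_zero, one_mul]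
      linarith [le_max_left ((S.V L N γ P u y ε 0).toReal - β) 0]
    | succ j ih =>
      intro hj
      obtain ⟨ih1, ih2⟩ := ih (by omega)
      obtain ⟨z, hz, happ⟩ := hrun j (by omega)
      have hVj : S.V L N γ P u y ε (j * n) = ((S.cost z + γ * DDMPC.wNorm P
          (DDMPC.stack (DDMPC.window n u (j * n)) (DDMPC.window n y (j * n))) : ℝ) : EReal) := by
        rw [DDMPC.Scheme.V, hz.optCost_eq, ← EReal.coe_add]
      rw [hVj, EReal.coe_le_coe_iff] at ih1 ih2
      have hwin : ∀ {q : ℕ} (v : ℕ → Fin q → ℝ) (s : ℕ),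
          DDMPC.window n (fun k => v (j * n + k)) s = DDMPC.window n v (j * n + s) :=
        fun v s => DDMPC.window_shift n v (j * n) s
      have hmeas : ∀ s, DDMPC.window n ((fun k => y (j * n + k)) + fun k => ε (j * n + k)) s =
          DDMPC.window n (y + ε) (j * n + s) := fun s => hwin (y + ε) s
      obtain ⟨z', hz', hdec⟩ := hstepc S xd yd εd hS rfl rfl rfl rfl rfl hεε₀ hcpeε
        (fun k => u (j * n + k)) (fun k => x (j * n + k)) (fun k => y (j * n + k))
        (fun k => ε (j * n + k)) z (fun k => hstep (j * n + k)) (fun k a => hnoise _ a)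
        (by rw [hwin, hmeas]; exact hz)
        (fun k hk => by rw [← add_assoc]; exact happ k hk)
        (by rw [hwin, hwin]; exact ih1)
      simp only [hwin, hmeas, add_zero, ← Nat.succ_mul] at hz' hdec
      change S.cost z' + _ ≤ (1 - θ) * _ + M * εbar ^ 2 at hdec
      rw [hβθ] at hdec
      have hVj1 : S.V L N γ P u y ε ((j + 1) * n) ≤ ((S.cost z' + γ * DDMPC.wNorm P
          (DDMPC.stack (DDMPC.window n u ((j + 1) * n)) (DDMPC.window n y ((j + 1) * n))) : ℝ) :
            EReal) := by
        rw [DDMPC.Scheme.V, EReal.coe_add]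
        exact add_le_add_left (DDMPC.Scheme.optCost_le hz') _
      have h1θ : 0 ≤ 1 - θ := by linarith
      have e1 := mul_le_mul_of_nonneg_left ih1 h1θ
      have e2 := mul_le_mul_of_nonneg_left ih2 h1θ
      have e3 := mul_le_mul_of_nonneg_left hβv hθ0.le
      -- With `M ε̄² = θ β` the new bound is the convex combination `(1 - θ) V + θ β`. It stays
      -- below `v₀` because `β` does, and its distance to `β` shrinks by `1 - θ`.
      refine ⟨hVj1.trans (EReal.coe_le_coe_iff.2 (hdec.trans (by linarith))),
        hVj1.trans (EReal.coe_le_coe_iff.2 (hdec.trans ?_))⟩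
      rw [pow_succ]
      linarith
  obtain ⟨h1, h2⟩ := key K le_rfl
  refine ⟨h1, h2, fun hUc => ?_⟩
  have hne : S.optCost L N (DDMPC.window n u (K * n)) (DDMPC.window n (y + ε) (K * n)) ≠ ⊤ := by
    intro htop
    rw [DDMPC.Scheme.V, htop, EReal.top_add_coe] at h1
    exact EReal.coe_ne_top v₀ (top_le_iff.1 h1)
  obtain ⟨z₀, hz₀⟩ := DDMPC.Scheme.exists_feasible_of_optCost_ne_top hne
  exact DDMPC.Scheme.exists_optimal hQ hR hUc (lt_of_lt_of_le one_pos hlα.1)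
    (lt_of_lt_of_le hlσ_min hlσ.1) hε hz₀
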